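/- Let $S^2\subset\mathbb R^3$ be the round unit sphere with its induced Riemannian metric and let $\mu$ be its area measure, normalized to be a probability measure. Let $PS^2$ be the projective bundle of $S^2$, whose points are the lines in the tangent planes $T_xS^2$, and let $m$ be the normalized Liouville measure on $PS^2$, i.e. the probability measure that projects to $\mu$ on $S^2$ and whose conditional measure on each fibre $P_xS^2$ is the uniform one. For a Borel probability measure $\nu$ on the group $\mathrm{Diff}^1(S^2)$ of $C^1$ diffeomorphisms (with the $C^1$ topology), the random exponent $R(\nu)$ is defined as follows. For an independent, $\nu$-distributed sequence $h=(h_i)_{i\ge1}$ put $h^{(n)}=h_n\circ\cdots\circ h_1$. If for $\nu^{\infty}$-almost every $h$ the limit $$R(x,h,\nu)=\lim_{n\to\infty}\frac1n\log\|T_xh^{(n)}\|$$ exists for $\mu$-almost every $x\in S^2$, is $\mu$-integrable in $x$, and $\int_{S^2}R(x,h,\nu)\,d\mu(x)$ has the same value for almost every $h$, then $R(\nu)$ is this value. Let $f$ be a $C^1$ diffeomorphism of $S^2$ that preserves $\mu$, and let $\nu$ be the push-forward of the Haar probability measure of $SO(3)$ under $g\mapsto g\circ f$, a measure on $\{g\circ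 f \mid g\in SO(3)\}$. Then the random exponent $R(\nu)$ exists, the function $v\mapsto\log\|Tf\,v\|$ (evaluated at a unit vector $v$ spanning the given line) is $m$-integrable, and $$R(\nu)=\int_{PS^2}\log\|Tf\,v\|\,dm(v).$$ Moreover, $R(\nu)>0$ unless $f$ is an isometry of $S^2$. -/

import Mathlib

open MeasureTheory Filter Set
open scoped Manifold ContDiff RealInnerProductSpace Topology

noncomputable section

namespace RandomSphere

/-! ### The round sphere and its normalized area -/

/-- Euclidean three-space. -/
abbrev E3 : Type := EuclideanSpace ℝ (Fin 3)

/-- The round sphere `S²`, as the unit sphere of `ℝ³`, with Mathlib's manifold structure. -/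
abbrev S2 : Type := Metric.sphere (0 : E3) 1

instance factFinrankE3 : Fact (Module.finrank ℝ E3 = 2 + 1) :=
  ⟨finrank_euclideanSpace_fin⟩

/-- Lebesgue measure (area) on `S²`, normalized to be a probability measure. -/
def area : Measure S2 := ProbabilityTheory.cond (volume : Measure E3).toSphere univ

/-- `C¹` diffeomorphisms of `S²`. -/
abbrev SphereDiffeo : Type := S2 ≃ₘ^1⟮𝓡 2, 𝓡 2⟯ S2

/-! ### Tangent maps

The tangent space at `x` is identified with the plane `x^⊥` in `ℝ³` by the differential of the
inclusion; the Riemannian norm is then the norm of `ℝ³`. -/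

/-- The differential at `x` of the inclusion of `S²` in `ℝ³`, as an isomorphism of the tangent
space at `x` with the plane orthogonal to `x`. -/
def tangentIso (x : S2) : TangentSpace (𝓡 2) x ≃ₗ[ℝ] (ℝ ∙ (x : E3))ᗮ :=
  (LinearEquiv.ofInjective (mvfderiv (𝓡 2) ((↑) : S2 → E3) x).toLinearMap
    (injective_mvfderiv_subtypeVal_sphere x)).trans
    (LinearEquiv.ofEq _ _ (range_mvfderiv_subtypeVal x))

/-- The tangent map `T_x F : T_x S² → T_{F x} S²`, tangent spaces being seen as planes in `ℝ³`. -/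
def sphereDeriv (F : S2 → S2) (x : S2) :
    (ℝ ∙ (x : E3))ᗮ →L[ℝ] (ℝ ∙ (F x : E3))ᗮ :=
  LinearMap.toContinuousLinearMap
    ((tangentIso (F x)).toLinearMap ∘ₗ (mfderiv (𝓡 2) (𝓡 2) F x).toLinearMap ∘ₗ
      (tangentIso x).symm.toLinearMap)

/-! ### The unit tangent bundle, the projective bundle and Liouville measure -/

/-- The unit tangent bundle `T₁S²`: pairs of a point `x` and a unit vector orthogonal to `x`. -/
abbrev UnitTangent : Type := {p : S2 × S2 // ⟪(p.1 : E3), (p.2 : E3)⟫ = 0}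

/-- The base point of a unit tangent vector. -/
def UnitTangent.base (p : UnitTangent) : S2 := p.1.1

/-- A unit tangent vector as an element of the tangent plane at its base point. -/
def UnitTangent.vec (p : UnitTangent) : (ℝ ∙ (p.base : E3))ᗮ :=
  ⟨(p.1.2 : E3), Submodule.mem_orthogonal_singleton_iff_inner_right.2 p.2⟩

/-- Unit tangent vectors span the same line if they have the same base point and agree up to
sign. -/
instance lineSetoid : Setoid UnitTangent where
  r p q := p.1.1 = q.1.1 ∧ (p.1.2 = q.1.2 ∨ p.1.2 = -q.1.2)
  iseqv :=
    { refl := fun _ => ⟨rfl, Or.inl rfl⟩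
      symm := by
        rintro p q ⟨h, h' | h'⟩
        · exact ⟨h.symm, Or.inl h'.symm⟩
        · exact ⟨h.symm, Or.inr (by rw [h', neg_neg])⟩
      trans := by
        rintro p q r ⟨h₁, h₂⟩ ⟨h₃, h₄⟩
        refine ⟨h₁.trans h₃, ?_⟩
        rcases h₂ with h₂ | h₂ <;> rcases h₄ with h₄ | h₄ <;> simp [h₂, h₄] }

/-- The projective bundle `PS²`, whose points are the lines in the tangent planes of `S²`; it
carries the quotient σ-algebra. -/
abbrev ProjTangent : Type := Quotient lineSetoid

/-- A Borel choice of a unit vector orthogonal to `x`: the eastward direction, and the first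
coordinate vector at the two poles. -/
def frameFst (x : S2) : E3 :=
  if (x : E3) 0 ^ 2 + (x : E3) 1 ^ 2 = 0 then !₂[1, 0, 0]
  else (Real.sqrt ((x : E3) 0 ^ 2 + (x : E3) 1 ^ 2))⁻¹ • !₂[-(x : E3) 1, (x : E3) 0, 0]

/-- The vector product of `x` and `frameFst x`, which completes `frameFst x` to an orthonormal
basis of the tangent plane at `x`. -/
def frameSnd (x : S2) : E3 :=
  WithLp.toLp 2 (crossProduct (WithLp.ofLp (x : E3)) (WithLp.ofLp (frameFst x)))

theorem sq_sum (x : S2) : (x : E3) 0 ^ 2 + (x : E3) 1 ^ 2 + (x : E3) 2 ^ 2 = 1 := by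
  have h : ‖(x : E3)‖ = 1 := by simp
  have := EuclideanSpace.real_norm_sq_eq (x : E3)
  rw [h, Fin.sum_univ_three] at this
  linarith

theorem frameFst_props (x : S2) :
    frameFst x 0 * (x : E3) 0 + frameFst x 1 * (x : E3) 1 + frameFst x 2 * (x : E3) 2 = 0 ∧
    frameFst x 0 ^ 2 + frameFst x 1 ^ 2 + frameFst x 2 ^ 2 = 1 := by
  unfold frameFst
  split_ifs with h
  · have h0 : (x : E3) 0 = 0 := by nlinarith [sq_nonneg ((x : E3) 0), sq_nonneg ((x : E3) 1)]
    simp [h0]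
  · have hs : Real.sqrt ((x : E3) 0 ^ 2 + (x : E3) 1 ^ 2) ≠ 0 := by
      rw [Real.sqrt_ne_zero (by positivity)]; exact h
    have h2 := Real.sq_sqrt (show 0 ≤ (x : E3) 0 ^ 2 + (x : E3) 1 ^ 2 by positivity)
    constructor
    · simp; ring
    · simp only [PiLp.smul_apply, smul_eq_mul]
      simp [mul_pow]
      field_simp
      linarith

/-- The unit vector `cos θ • a + sin θ • b` of the tangent plane at `x`, where `(a, b)` is the
chosen orthonormal basis of that plane. -/
def unitVec (x : S2) (θ : ℝ) : E3 := Real.cos θ • frameFst x + Real.sin θ • frameSnd x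

theorem unitVec_mem (x : S2) (θ : ℝ) : unitVec x θ ∈ Metric.sphere (0 : E3) 1 := by
  obtain ⟨h1, h2⟩ := frameFst_props x
  have h3 := sq_sum x
  have h4 := Real.sin_sq_add_cos_sq θ
  rw [mem_sphere_zero_iff_norm, ← sq_eq_sq₀ (norm_nonneg _) zero_le_one,
    EuclideanSpace.real_norm_sq_eq, Fin.sum_univ_three]
  simp [unitVec, frameSnd, crossProduct]
  generalize frameFst x 0 = a at *
  generalize frameFst x 1 = b at *
  generalize frameFst x 2 = c at *
  generalize (x : E3) 0 = u at *
  generalize (x : E3) 1 = v at *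
  generalize (x : E3) 2 = w at *
  generalize Real.cos θ = k at *
  generalize Real.sin θ = s at *
  have h5 : (v * c - w * b) ^ 2 + (w * a - u * c) ^ 2 + (u * b - v * a) ^ 2 = 1 := by
    have : (v * c - w * b) ^ 2 + (w * a - u * c) ^ 2 + (u * b - v * a) ^ 2
      = (u^2+v^2+w^2) * (a^2+b^2+c^2) - (a*u+b*v+c*w)^2 := by ring
    rw [this, h1, h2, h3]; norm_num
  linear_combination k ^ 2 * h2 + s ^ 2 * h5 + h4

theorem inner_unitVec (x : S2) (θ : ℝ) : ⟪(x : E3), unitVec x θ⟫ = 0 := by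
  obtain ⟨h1, -⟩ := frameFst_props x
  simp [unitVec, frameSnd, crossProduct, PiLp.inner_apply, Fin.sum_univ_three]
  linear_combination Real.cos θ * h1

/-- The unit tangent vector at `x` with angle `θ` in the chosen basis. -/
def unitTangentOf (q : S2 × ℝ) : UnitTangent :=
  ⟨(q.1, ⟨unitVec q.1 q.2, unitVec_mem q.1 q.2⟩), inner_unitVec q.1 q.2⟩

/-- Normalized Liouville measure on `T₁S²`: the base point is distributed according to
normalized area and, given the base point, the vector is uniformly distributed on the unit circle
of the tangent plane. (The circle is parametrized by an angle; a different orthonormal basis of the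
plane shifts or reflects the angle and gives the same measure.) -/
def liouvilleUnit : Measure UnitTangent :=
  (area.prod (ProbabilityTheory.cond (volume : Measure ℝ) (Ioc 0 (2 * Real.pi)))).map
    unitTangentOf

/-- Normalized Liouville measure `m` on `PS²`. -/
def liouville : Measure ProjTangent := liouvilleUnit.map (Quotient.mk lineSetoid)

/-- The function `v ↦ log ‖T F v‖` on `PS²`, where a line is represented by either of its unit
vectors. -/
def logStretch (F : S2 → S2) : ProjTangent → ℝ :=
  Quotient.lift (fun p : UnitTangent => Real.log ‖sphereDeriv F p.base p.vec‖) (by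
    rintro ⟨⟨x, v⟩, hp⟩ ⟨⟨y, w⟩, hq⟩ ⟨h₁, h₂⟩
    obtain rfl : x = y := h₁
    rcases h₂ with h₂ | h₂
    · obtain rfl : v = w := h₂
      rfl
    · obtain rfl : v = -w := h₂
      have : UnitTangent.vec ⟨(x, -w), hp⟩ = -UnitTangent.vec ⟨(x, w), hq⟩ := rfl
      change Real.log ‖sphereDeriv F x (UnitTangent.vec ⟨(x, -w), hp⟩)‖ =
        Real.log ‖sphereDeriv F x (UnitTangent.vec ⟨(x, w), hq⟩)‖
      rw [this]
      congr 1
      exact (congrArg norm (map_neg (sphereDeriv F x) (UnitTangent.vec ⟨(x, w), hq⟩))).trans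
        (norm_neg _))

/-! ### Random composition of diffeomorphisms -/

/-- The 1-jet of `F`, as a function on the unit tangent bundle. -/
def jet (F : S2 → S2) (p : UnitTangent) : E3 × E3 :=
  ((F p.base : E3), (sphereDeriv F p.base p.vec : E3))

/-- The `C¹` topology on diffeomorphisms of the sphere: uniform convergence of the maps and of
their tangent maps on unit vectors. -/
instance diffeoTopology : TopologicalSpace SphereDiffeo :=
  TopologicalSpace.induced (fun f => UniformFun.ofFun (jet f)) inferInstance

instance diffeoMeasurableSpace : MeasurableSpace SphereDiffeo := borel SphereDiffeo

instance diffeoBorelSpace : BorelSpace SphereDiffeo := ⟨rfl⟩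

/-- The composition `h^{(n)} = h_n ∘ ⋯ ∘ h_1` (the sequence being indexed from `0`). -/
def iterComp (h : ℕ → SphereDiffeo) : ℕ → SphereDiffeo
  | 0 => Diffeomorph.refl (𝓡 2) S2 1
  | n + 1 => (iterComp h n).trans (h n)

/-- `R` is the random exponent of the Borel probability measure `ν` on diffeomorphisms of `S²`:
for almost every independent `ν`-distributed sequence, the limit of `n⁻¹ log ‖T_x h^{(n)}‖` exists
for almost every `x`, and its integral over the sphere is `R`. -/
def HasRandomExponent (ν : Measure SphereDiffeo) [IsProbabilityMeasure ν] (R : ℝ) : Prop :=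
  ∀ᵐ h ∂Measure.infinitePi (fun _ : ℕ => ν), ∃ L : S2 → ℝ,
    (∀ᵐ x ∂area, Tendsto
      (fun n : ℕ => (1 / (n : ℝ)) * Real.log ‖sphereDeriv (iterComp h n) x‖) atTop (𝓝 (L x))) ∧
    Integrable L area ∧ ∫ x, L x ∂area = R

theorem HasRandomExponent.unique {ν : Measure SphereDiffeo} [IsProbabilityMeasure ν] {R R' : ℝ}
    (h : HasRandomExponent ν R) (h' : HasRandomExponent ν R') : R = R' := by
  obtain ⟨w, ⟨L, hL, -, hR⟩, ⟨L', hL', -, hR'⟩⟩ := (h.and h').exists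
  rw [← hR, ← hR']
  refine integral_congr_ae ?_
  filter_upwards [hL, hL'] with x hx hx'
  exact tendsto_nhds_unique hx hx'

/-! ### Rotations, Haar measure and the coset of a diffeomorphism -/

/-- The rotation group. -/
abbrev SO3 : Type := Matrix.specialOrthogonalGroup (Fin 3) ℝ

instance : MeasurableSpace SO3 := borel SO3

instance : BorelSpace SO3 := ⟨rfl⟩

instance : IsTopologicalGroup SO3 where
  continuous_inv :=
    Continuous.subtype_mk (continuous_subtype_val.matrix_conjTranspose) _

instance : CompactSpace SO3 := by
  refine (isCompact_iff_compactSpace (s := ((Matrix.specialOrthogonalGroup (Fin 3) ℝ :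
    Submonoid (Matrix (Fin 3) (Fin 3) ℝ)) : Set (Matrix (Fin 3) (Fin 3) ℝ)))).1 ?_
  have hK : IsCompact (Set.pi univ fun _ : Fin 3 => Set.pi univ fun _ : Fin 3 => Icc (-1 : ℝ) 1) :=
    isCompact_univ_pi fun _ => isCompact_univ_pi fun _ => isCompact_Icc
  refine IsCompact.of_isClosed_subset (X := Matrix (Fin 3) (Fin 3) ℝ) hK ?_ ?_
  · have : ((Matrix.specialOrthogonalGroup (Fin 3) ℝ : Submonoid _) :
        Set (Matrix (Fin 3) (Fin 3) ℝ)) = {A | A * A.transpose = 1} ∩ {A | A.det = 1} := by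
      ext A
      simp [Matrix.mem_specialOrthogonalGroup_iff, Matrix.mem_orthogonalGroup_iff]
    rw [this]
    exact (isClosed_eq (continuous_id.matrix_mul continuous_id.matrix_transpose)
      continuous_const).inter (isClosed_eq continuous_id.matrix_det continuous_const)
  · intro A hA i _ j _
    have := entry_norm_bound_of_unitary (𝕜 := ℝ) hA.1 i j
    exact abs_le.1 this

/-- Haar measure on the rotation group, of total mass one. -/
def haarSO3 : Measure SO3 := Measure.haarMeasure ⊤

/-- The linear action of a rotation on `ℝ³`. -/
def rotLin (g : SO3) : E3 →L[ℝ] E3 := Matrix.toEuclideanCLM (𝕜 := ℝ) (g : Matrix _ _ ℝ)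

theorem rotLin_mul (g k : SO3) (y : E3) : rotLin (g * k) y = rotLin g (rotLin k y) := by
  simp [rotLin]

theorem rotLin_one (y : E3) : rotLin 1 y = y := by
  simp [rotLin]

theorem norm_rotLin (g : SO3) (y : E3) : ‖rotLin g y‖ = ‖y‖ := by
  have hu : rotLin g ∈ unitary (E3 →L[ℝ] E3) :=
    Unitary.map_mem (Matrix.toEuclideanCLM (n := Fin 3) (𝕜 := ℝ)) g.2.1
  exact (Unitary.linearIsometryEquiv ⟨_, hu⟩).norm_map y

theorem rotLin_mem (g : SO3) (x : S2) : rotLin g x ∈ Metric.sphere (0 : E3) 1 := by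
  simp [norm_rotLin]

/-- The action of a rotation on the sphere. -/
def rotFun (g : SO3) (x : S2) : S2 := ⟨rotLin g x, rotLin_mem g x⟩

theorem contMDiff_rotFun (g : SO3) : ContMDiff (𝓡 2) (𝓡 2) 1 (rotFun g) :=
  ContMDiff.codRestrict_sphere (n := 2)
    ((rotLin g).contMDiff.comp contMDiff_coe_sphere) (rotLin_mem g)

/-- A rotation as a diffeomorphism of the sphere. -/
def rot (g : SO3) : SphereDiffeo where
  toFun := rotFun g
  invFun := rotFun g⁻¹
  left_inv x := Subtype.ext (by simp [rotFun, ← rotLin_mul, rotLin_one])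
  right_inv x := Subtype.ext (by simp [rotFun, ← rotLin_mul, rotLin_one])
  contMDiff_toFun := contMDiff_rotFun g
  contMDiff_invFun := contMDiff_rotFun g⁻¹

/-- The push-forward `ν` of Haar measure on `SO(3)` to the coset `{g ∘ f | g ∈ SO(3)}` in the
group of diffeomorphisms of the sphere, under `g ↦ g ∘ f`. -/
def cosetMeasure (f : SphereDiffeo) : Measure SphereDiffeo :=
  haarSO3.map fun g => f.trans (rot g)

/-! ### The push-forward is a probability measure

What follows shows that `g ↦ g ∘ f` is continuous for the `C¹` topology. -/

theorem coe_tangentIso (x : S2) (w : TangentSpace (𝓡 2) x) :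
    (tangentIso x w : E3) = mvfderiv (𝓡 2) ((↑) : S2 → E3) x w := rfl

theorem sphereDeriv_tangentIso (F : S2 → S2) (x : S2) (w : TangentSpace (𝓡 2) x) :
    sphereDeriv F x (tangentIso x w) = tangentIso (F x) (mfderiv (𝓡 2) (𝓡 2) F x w) := by
  simp [sphereDeriv]

theorem hasMFDerivAt_coe (x : S2) : HasMFDerivAt (𝓡 2) 𝓘(ℝ, E3) ((↑) : S2 → E3) x
    (mfderiv (𝓡 2) 𝓘(ℝ, E3) ((↑) : S2 → E3) x) :=
  ((contMDiff_coe_sphere (m := 1) x).mdifferentiableAt one_ne_zero).hasMFDerivAt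

/-- If `G : ℝ³ → ℝ³` extends `F` then its derivative extends the tangent map of `F`. -/
theorem coe_sphereDeriv_of_extension {F : S2 → S2} {x : S2}
    (hF : MDifferentiableAt (𝓡 2) (𝓡 2) F x) {G : E3 → E3} (hG : DifferentiableAt ℝ G x)
    (h : ∀ y : S2, G y = F y) (v : (ℝ ∙ (x : E3))ᗮ) :
    (sphereDeriv F x v : E3) = fderiv ℝ G x v := by
  obtain ⟨w, rfl⟩ := (tangentIso x).surjective v
  rw [sphereDeriv_tangentIso, coe_tangentIso, coe_tangentIso]
  have h1 := (hasMFDerivAt_coe (F x)).comp x hF.hasMFDerivAt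
  have h2 := (hG.hasFDerivAt.hasMFDerivAt).comp x (hasMFDerivAt_coe x)
  have h3 : ((↑) : S2 → E3) ∘ F = G ∘ ((↑) : S2 → E3) := by
    funext y; exact (h y).symm
  rw [h3] at h1
  exact congrArg (fun l => l w) (hasMFDerivAt_unique h1 h2)

theorem coe_sphereDeriv_rot_comp (f : SphereDiffeo) (g : SO3) (x : S2) (v : (ℝ ∙ (x : E3))ᗮ) :
    (sphereDeriv (f.trans (rot g)) x v : E3) = rotLin g (sphereDeriv f x v) := by
  obtain ⟨w, rfl⟩ := (tangentIso x).surjective v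
  rw [sphereDeriv_tangentIso, sphereDeriv_tangentIso, coe_tangentIso, coe_tangentIso]
  have hf := (f.contMDiff_toFun x).mdifferentiableAt one_ne_zero
  have hfg := ((f.trans (rot g)).contMDiff_toFun x).mdifferentiableAt one_ne_zero
  have h1 := (hasMFDerivAt_coe (f.trans (rot g) x)).comp x hfg.hasMFDerivAt
  have h2 := ((rotLin g).hasFDerivAt.hasMFDerivAt).comp x
    ((hasMFDerivAt_coe (f x)).comp x hf.hasMFDerivAt)
  exact congrArg (fun l => l w) (hasMFDerivAt_unique h1 h2)

theorem contDiffAt_extension (f : SphereDiffeo) :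
    ∃ G : E3 → E3, (∀ y : S2, G y = f y) ∧ ContDiffOn ℝ 1 G {0}ᶜ := by
  let U : TopologicalSpace.Opens E3 := ⟨{0}ᶜ, isOpen_compl_singleton⟩
  have hn : ∀ y : U, ‖(y : E3)‖⁻¹ • (y : E3) ∈ Metric.sphere (0 : E3) 1 := by
    intro y
    have : ‖(y : E3)‖ ≠ 0 := norm_ne_zero_iff.2 y.2
    rw [mem_sphere_zero_iff_norm, norm_smul, norm_inv, norm_norm, inv_mul_cancel₀ this]
  have h1 : ContMDiff 𝓘(ℝ, E3) 𝓘(ℝ, E3) 1 fun y : U => ‖(y : E3)‖⁻¹ • (y : E3) := by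
    intro y
    have hy : (y : E3) ≠ 0 := y.2
    have : ContDiffAt ℝ 1 (fun z : E3 => ‖z‖⁻¹ • z) y :=
      ((contDiffAt_norm ℝ hy).inv (norm_ne_zero_iff.2 hy)).smul contDiffAt_id
    exact this.contMDiffAt.comp y contMDiff_subtype_val.contMDiffAt
  have h2 := ContMDiff.codRestrict_sphere (n := 2) h1 hn
  have h3 := (contMDiff_coe_sphere (m := 1) (n := 2)).comp (f.contMDiff_toFun.comp h2)
  classical
  let G : E3 → E3 := fun y => if h : y ∈ U then (f ⟨‖y‖⁻¹ • y, hn ⟨y, h⟩⟩ : E3) else 0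
  refine ⟨G, ?_, ?_⟩
  · intro y
    have hy : (y : E3) ∈ U := ne_zero_of_mem_unit_sphere y
    have : (⟨‖(y : E3)‖⁻¹ • (y : E3), hn ⟨y, hy⟩⟩ : S2) = y := Subtype.ext (by simp)
    simp only [G, dif_pos hy, this]
  · intro y hy
    have h4 : ContMDiffAt 𝓘(ℝ, E3) 𝓘(ℝ, E3) 1 (fun z : U => G z) ⟨y, hy⟩ := by
      refine (h3 ⟨y, hy⟩).congr_of_eventuallyEq (Eventually.of_forall fun z => ?_)
      simp only [G, dif_pos z.2]
      rfl
    exact ((contMDiffAt_subtype_iff (U := U) (f := G) (x := ⟨y, hy⟩)).1 h4).contDiffAt.contDiffWithinAt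

theorem exists_norm_sphereDeriv_le (f : SphereDiffeo) :
    ∃ C : ℝ, ∀ p : UnitTangent, ‖(sphereDeriv f p.base p.vec : E3)‖ ≤ C := by
  obtain ⟨G, hG, hG'⟩ := contDiffAt_extension f
  have hc : ContinuousOn (fderiv ℝ G) {0}ᶜ :=
    hG'.continuousOn_fderiv_of_isOpen isOpen_compl_singleton le_rfl
  obtain ⟨C, hC⟩ := (isCompact_sphere (0 : E3) 1).exists_bound_of_continuousOn
    (hc.mono fun y hy => ne_zero_of_mem_unit_sphere ⟨y, hy⟩)
  refine ⟨C, fun p => ?_⟩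
  have hp : (p.base : E3) ∈ ({0}ᶜ : Set E3) := ne_zero_of_mem_unit_sphere p.base
  rw [coe_sphereDeriv_of_extension (F := f) ((f.contMDiff_toFun _).mdifferentiableAt one_ne_zero)
    ((hG'.contDiffAt (isOpen_compl_singleton.mem_nhds hp)).differentiableAt one_ne_zero) hG]
  refine (ContinuousLinearMap.le_opNorm _ _).trans ?_
  have : ‖((p.vec : (ℝ ∙ (p.base : E3))ᗮ) : E3)‖ = 1 := by
    simp [UnitTangent.vec]
  rw [this, mul_one]
  exact hC _ p.base.2

theorem continuous_coset (f : SphereDiffeo) :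
    Continuous fun g : SO3 => f.trans (rot g) := by
  obtain ⟨C, hC⟩ := exists_norm_sphereDeriv_le f
  have hrot : Continuous rotLin :=
    (LinearMap.continuous_of_finiteDimensional
      (Matrix.toEuclideanCLM (n := Fin 3) (𝕜 := ℝ)).toAlgEquiv.toLinearMap).comp
      continuous_subtype_val
  rw [continuous_induced_rng, continuous_iff_continuousAt]
  intro g₀
  rw [ContinuousAt, UniformFun.tendsto_iff_tendstoUniformly, Metric.tendstoUniformly_iff]
  intro ε hε
  have hD : 0 < max 1 C + 1 := by positivity
  have := (hrot.tendsto g₀).eventually (Metric.ball_mem_nhds _ (div_pos hε hD))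
  filter_upwards [this] with g hg p
  rw [dist_comm, dist_eq_norm] at hg
  have key : ∀ y : E3, ‖y‖ ≤ max 1 C → dist (rotLin g₀ y) (rotLin g y) < ε := by
    intro y hy
    rw [dist_eq_norm, ← sub_apply]
    calc _ ≤ ‖rotLin g₀ - rotLin g‖ * ‖y‖ := ContinuousLinearMap.le_opNorm _ _
      _ ≤ ε / (max 1 C + 1) * max 1 C := by gcongr
      _ < ε / (max 1 C + 1) * (max 1 C + 1) := by gcongr; linarith
      _ = ε := div_mul_cancel₀ _ hD.ne'
  have h1 := key (f p.base) (by simp)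
  have h2 := key (sphereDeriv f p.base p.vec) ((hC p).trans (le_max_right _ _))
  rw [← coe_sphereDeriv_rot_comp, ← coe_sphereDeriv_rot_comp] at h2
  exact max_lt h1 h2

instance : IsProbabilityMeasure haarSO3 :=
  ⟨by simpa [haarSO3] using Measure.haarMeasure_self (K₀ := (⊤ : TopologicalSpace.PositiveCompacts SO3))⟩

instance (f : SphereDiffeo) : IsProbabilityMeasure (cosetMeasure f) :=
  Measure.isProbabilityMeasure_map (continuous_coset f).measurable.aemeasurable
end RandomSphere
end

open RandomSphere

/-! Composing with a Haar-random rotation forgets everything except stretching. Rotations act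
transitively on unit tangent vectors and Haar measure is right invariant, so the normalized image of
any unit vector under a random `g ∘ f` has Liouville law, whatever the vector was
(`map_pushTangent_cosetMeasure`). Along a random orbit the directions after time zero are therefore
Liouville distributed, and each is independent of every earlier one (`indepFun_orbit_succ`).
Rotations preserve norms, so by the chain rule the logarithmic growth of a vector is a sum of values
of `log ‖Tf v‖` along its orbit, and the strong law of large numbers gives the Liouville mean as
growth rate of every fixed unit tangent vector, almost surely. Fubini exchanges "for all `x`, almost
every `h`" with "almost every `h`, almost every `x`"; applied to the two vectors of a frame, this
controls the operator norm.

For positivity, area preservation gives the tangent map Jacobian one. Its first fundamental form `E,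
F, G` then satisfies `EG - F² = 1`, and the mean of `log ‖Tf v‖` over the unit circle at `x` is `½
log ((E + G + 2) / 4)` (`average_log_quadratic`). This is nonnegative as `E + G ≥ 2`, and zero only
where the tangent map is isometric. If the integral vanishes, that happens almost everywhere, hence
everywhere by continuity, and `f` is an isometry.

Tangent maps are computed through the degree-one homogeneous extension of `f` to `ℝ³`, which turns
calculus on the sphere into calculus on `ℝ³ ∖ {0}`. -/

noncomputable section

namespace RandomSphere

/-! ### The homogeneous extension of a diffeomorphism of the sphere -/

/-- The extension of `f` to `ℝ³` that is positively homogeneous of degree one. -/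
def homExt (f : S2 → S2) (y : E3) : E3 :=
  if h : y = 0 then 0 else ‖y‖ • (f ⟨‖y‖⁻¹ • y, by simp [norm_smul, h]⟩ : E3)

theorem homExt_zero (f : S2 → S2) : homExt f 0 = 0 := by simp [homExt]

theorem homExt_of_ne_zero (f : S2 → S2) {y : E3} (h : y ≠ 0) :
    homExt f y = ‖y‖ • (f ⟨‖y‖⁻¹ • y, by simp [norm_smul, h]⟩ : E3) := by
  simp [homExt, h]

theorem homExt_smul (f : S2 → S2) {r : ℝ} (hr : 0 < r) (x : S2) :
    homExt f (r • (x : E3)) = r • (f x : E3) := by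
  have hx : (x : E3) ≠ 0 := ne_zero_of_mem_unit_sphere x
  rw [homExt_of_ne_zero f (smul_ne_zero hr.ne' hx)]
  have h1 : ‖r • (x : E3)‖ = r := by simp [norm_smul, abs_of_pos hr]
  congr 3
  apply Subtype.ext
  simp only [h1]
  rw [smul_smul, inv_mul_cancel₀ hr.ne', one_smul]

theorem homExt_coe (f : S2 → S2) (x : S2) : homExt f x = f x := by
  simpa using homExt_smul f one_pos x

theorem exists_eq_smul_coe {y : E3} (hy : y ≠ 0) : ∃ r : ℝ, 0 < r ∧ ∃ x : S2, y = r • (x : E3) :=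
  ⟨‖y‖, norm_pos_iff.2 hy, ⟨‖y‖⁻¹ • y, by simp [norm_smul, hy]⟩, by
    simp [smul_smul, norm_ne_zero_iff.2 hy]⟩

theorem homExt_ne_zero (f : S2 → S2) {y : E3} (hy : y ≠ 0) : homExt f y ≠ 0 := by
  obtain ⟨r, hr, x, rfl⟩ := exists_eq_smul_coe hy
  rw [homExt_smul f hr]
  exact smul_ne_zero hr.ne' (ne_zero_of_mem_unit_sphere _)

theorem homExt_comp (f g : S2 → S2) : homExt (g ∘ f) = homExt g ∘ homExt f := by
  funext y
  by_cases hy : y = 0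
  · simp [hy, homExt_zero]
  · obtain ⟨r, hr, x, rfl⟩ := exists_eq_smul_coe hy
    simp [homExt_smul _ hr]

theorem homExt_id : homExt (fun x => x) = id := by
  funext y
  by_cases hy : y = 0
  · simp [hy, homExt_zero]
  · obtain ⟨r, hr, x, rfl⟩ := exists_eq_smul_coe hy
    simp [homExt_smul _ hr]

theorem homExt_symm_comp (f : SphereDiffeo) : homExt f.symm ∘ homExt f = id := by
  rw [← homExt_comp, ← homExt_id]
  congr 1
  funext x
  simp

/-- Away from `0` the homogeneous extension is `z ↦ ‖z‖ • G (z / ‖z‖)` for any smooth extension `G`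
of `f`. -/
theorem contDiffOn_homExt (f : SphereDiffeo) : ContDiffOn ℝ 1 (homExt f) {0}ᶜ := by
  obtain ⟨G, hG, hG'⟩ := contDiffAt_extension f
  have h : ∀ y ∈ ({0}ᶜ : Set E3), ContDiffAt ℝ 1 (fun z : E3 => ‖z‖ • G (‖z‖⁻¹ • z)) y := by
    intro y hy
    have hy' : y ≠ 0 := hy
    have hn : ‖y‖⁻¹ • y ∈ ({0}ᶜ : Set E3) := by simp [hy']
    have h1 : ContDiffAt ℝ 1 (fun z : E3 => ‖z‖⁻¹ • z) y :=
      ((contDiffAt_norm ℝ hy').inv (norm_ne_zero_iff.2 hy')).smul contDiffAt_id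
    have h2 : ContDiffAt ℝ 1 (G ∘ fun z : E3 => ‖z‖⁻¹ • z) y :=
      ContDiffAt.comp y (hG'.contDiffAt (isOpen_compl_singleton.mem_nhds hn)) h1
    exact (contDiffAt_norm ℝ hy').smul h2
  refine ContDiffOn.congr (fun y hy => (h y hy).contDiffWithinAt) fun y hy => ?_
  rw [homExt_of_ne_zero f hy]
  simp [← hG]

/-- The differential of the homogeneous extension. -/
def extDeriv (f : SphereDiffeo) (y : E3) : E3 →L[ℝ] E3 := fderiv ℝ (homExt f) y

theorem hasFDerivAt_homExt (f : SphereDiffeo) {y : E3} (hy : y ≠ 0) :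
    HasFDerivAt (homExt f) (extDeriv f y) y :=
  (((contDiffOn_homExt f).contDiffAt (isOpen_compl_singleton.mem_nhds hy)).differentiableAt
    one_ne_zero).hasFDerivAt

theorem continuousOn_extDeriv (f : SphereDiffeo) : ContinuousOn (extDeriv f) {0}ᶜ :=
  (contDiffOn_homExt f).continuousOn_fderiv_of_isOpen isOpen_compl_singleton le_rfl

theorem continuous_extDeriv_coe (f : SphereDiffeo) : Continuous fun x : S2 => extDeriv f x :=
  (continuousOn_extDeriv f).comp_continuous continuous_subtype_val
    fun x => ne_zero_of_mem_unit_sphere x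

/-- The bridge from the intrinsic tangent map to calculus in `ℝ³`. -/
theorem coe_sphereDeriv (f : SphereDiffeo) (x : S2) (v : (ℝ ∙ (x : E3))ᗮ) :
    (sphereDeriv f x v : E3) = extDeriv f x v :=
  coe_sphereDeriv_of_extension ((f.contMDiff_toFun x).mdifferentiableAt one_ne_zero)
    (hasFDerivAt_homExt f (ne_zero_of_mem_unit_sphere x)).differentiableAt (homExt_coe f) v

/-- Euler's identity for the homogeneous extension. -/
theorem extDeriv_self (f : SphereDiffeo) (x : S2) : extDeriv f x x = f x := by
  have h1 : HasDerivAt (fun r : ℝ => r • (x : E3)) ((1 : ℝ) • (x : E3)) 1 :=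
    (hasDerivAt_id (1 : ℝ)).smul_const _
  have h2 : HasDerivAt (fun r : ℝ => r • (f x : E3)) ((1 : ℝ) • (f x : E3)) 1 :=
    (hasDerivAt_id (1 : ℝ)).smul_const _
  have h3 : HasFDerivAt (homExt f) (extDeriv f x) ((1 : ℝ) • (x : E3)) := by
    rw [one_smul]
    exact hasFDerivAt_homExt f (ne_zero_of_mem_unit_sphere x)
  have h4 := h3.comp_hasDerivAt (1 : ℝ) h1
  have h5 : (homExt f ∘ fun r : ℝ => r • (x : E3)) =ᶠ[𝓝 1] fun r : ℝ => r • (f x : E3) := by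
    filter_upwards [lt_mem_nhds (zero_lt_one (α := ℝ))] with r hr
    exact homExt_smul f hr x
  have := (h4.congr_of_eventuallyEq h5.symm).unique h2
  simpa using this

/-- The differential of the extension does not depend on the radius. -/
theorem extDeriv_smul (f : SphereDiffeo) {r : ℝ} (hr : 0 < r) (x : S2) :
    extDeriv f (r • (x : E3)) = extDeriv f x := by
  have hx : (x : E3) ≠ 0 := ne_zero_of_mem_unit_sphere x
  have h1 : HasFDerivAt (fun y : E3 => r • y) (r • ContinuousLinearMap.id ℝ E3) (x : E3) :=
    (hasFDerivAt_id _).const_smul r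
  have h2 := (hasFDerivAt_homExt f (smul_ne_zero hr.ne' hx)).comp (x : E3) h1
  have h3 := (hasFDerivAt_homExt f hx).const_smul r
  have h4 : homExt f ∘ (fun y : E3 => r • y) = r • homExt f := by
    funext y
    by_cases hy : y = 0
    · simp [hy, homExt_zero]
    · obtain ⟨s, hs, z, rfl⟩ := exists_eq_smul_coe hy
      simp [smul_smul, homExt_smul f (mul_pos hr hs), homExt_smul f hs]
  rw [h4] at h2
  have h5 := h2.unique h3
  ext1 v
  have := congrArg (fun l => l v) h5
  simp only [ContinuousLinearMap.comp_apply, smul_apply,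
    ContinuousLinearMap.id_apply, map_smul] at this
  exact smul_right_injective _ hr.ne' this

theorem extDeriv_trans (f g : SphereDiffeo) (x : S2) :
    extDeriv (f.trans g) x = (extDeriv g (f x)).comp (extDeriv f x) := by
  have hx : (x : E3) ≠ 0 := ne_zero_of_mem_unit_sphere x
  have h1 := hasFDerivAt_homExt (f.trans g) hx
  have h2 : HasFDerivAt (homExt g) (extDeriv g (f x)) (homExt f x) := by
    rw [homExt_coe]
    exact hasFDerivAt_homExt g (ne_zero_of_mem_unit_sphere _)
  have h3 := h2.comp (x : E3) (hasFDerivAt_homExt f hx)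
  rw [Diffeomorph.coe_trans, homExt_comp] at h1
  exact h1.unique h3

theorem extDeriv_symm_apply (f : SphereDiffeo) (x : S2) (v : E3) :
    extDeriv f.symm (f x) (extDeriv f x v) = v := by
  have hx : (x : E3) ≠ 0 := ne_zero_of_mem_unit_sphere x
  have h2 : HasFDerivAt (homExt f.symm) (extDeriv f.symm (f x)) (homExt f x) := by
    rw [homExt_coe]
    exact hasFDerivAt_homExt _ (ne_zero_of_mem_unit_sphere _)
  have h3 := h2.comp (x : E3) (hasFDerivAt_homExt f hx)
  rw [homExt_symm_comp] at h3
  exact congrArg (fun l => l v) (h3.unique (hasFDerivAt_id (x : E3)))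

theorem extDeriv_ne_zero (f : SphereDiffeo) (x : S2) {v : E3} (hv : v ≠ 0) :
    extDeriv f x v ≠ 0 := by
  intro h
  apply hv
  rw [← extDeriv_symm_apply f x v, h, map_zero]

theorem inner_extDeriv (f : SphereDiffeo) (x : S2) {v : E3} (hv : ⟪(x : E3), v⟫ = 0) :
    ⟪(f x : E3), extDeriv f x v⟫ = 0 := by
  have := coe_sphereDeriv f x ⟨v, Submodule.mem_orthogonal_singleton_iff_inner_right.2 hv⟩
  rw [← this]
  exact Submodule.mem_orthogonal_singleton_iff_inner_right.1 (Subtype.coe_prop _)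

theorem jet_eq (f : SphereDiffeo) (p : UnitTangent) :
    jet f p = ((f p.base : E3), extDeriv f p.1.1 p.1.2) :=
  Prod.ext rfl (coe_sphereDeriv f p.base p.vec)

theorem continuous_jet (f : SphereDiffeo) : Continuous (jet f) := by
  have h : jet f = fun p => ((f p.base : E3), extDeriv f p.1.1 p.1.2) := funext (jet_eq f)
  rw [h]
  have hb : Continuous fun p : UnitTangent => p.1.1 := by fun_prop
  refine Continuous.prodMk (continuous_subtype_val.comp (f.continuous.comp hb)) ?_
  exact ((continuous_extDeriv_coe f).comp hb).clm_apply (by fun_prop)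

/-! ### Area-preserving diffeomorphisms have Jacobian one -/

theorem area_eq : area = ((volume : Measure E3).toSphere univ)⁻¹ • (volume : Measure E3).toSphere := by
  simp [area, ProbabilityTheory.cond]

theorem toSphere_univ_ne_zero : (volume : Measure E3).toSphere univ ≠ 0 := by
  rw [Ne, Measure.measure_univ_eq_zero]
  exact Measure.toSphere_ne_zero _

instance : IsProbabilityMeasure area :=
  ProbabilityTheory.cond_isProbabilityMeasure toSphere_univ_ne_zero

instance : area.IsOpenPosMeasure := by
  rw [area_eq]
  refine ⟨fun U hU hne => ?_⟩
  rw [Measure.smul_apply, smul_eq_mul]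
  exact mul_ne_zero (ENNReal.inv_ne_zero.2 (measure_ne_top _ _)) (hU.measure_ne_zero _ hne)

theorem toSphere_eq : (volume : Measure E3).toSphere =
    (volume : Measure E3).toSphere univ • area := by
  rw [area_eq, smul_smul, ENNReal.mul_inv_cancel toSphere_univ_ne_zero (measure_ne_top _ _),
    one_smul]

theorem measurePreserving_toSphere {f : S2 → S2} (hf : MeasurePreserving f area area) :
    MeasurePreserving f (volume : Measure E3).toSphere (volume : Measure E3).toSphere := by
  rw [toSphere_eq]
  exact hf.smul_measure _

theorem measurePreserving_area {f : S2 → S2}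
    (hf : MeasurePreserving f (volume : Measure E3).toSphere (volume : Measure E3).toSphere) :
    MeasurePreserving f area area := by
  rw [area_eq]
  exact hf.smul_measure _

/-- The homogeneous extension as a self-map of punctured space. -/
def puncturedExt (f : S2 → S2) (y : ({0}ᶜ : Set E3)) : ({0}ᶜ : Set E3) :=
  ⟨homExt f y, homExt_ne_zero f y.2⟩

theorem puncturedExt_eq (f : S2 → S2) :
    puncturedExt f = (homeomorphUnitSphereProd E3).symm ∘ Prod.map f id ∘
      homeomorphUnitSphereProd E3 := by
  funext y
  apply Subtype.ext
  simp only [puncturedExt, Function.comp_apply, homeomorphUnitSphereProd_symm_apply_coe,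
    Prod.map_fst, Prod.map_snd, id]
  rw [homExt_of_ne_zero f y.2, homeomorphUnitSphereProd_apply_snd_coe]
  congr 3
  exact Subtype.ext (homeomorphUnitSphereProd_apply_fst_coe E3 y).symm

/-- In polar coordinates Lebesgue measure is a product and the extension is `f × id`. -/
theorem measurePreserving_puncturedExt {f : S2 → S2} (hf : MeasurePreserving f area area) :
    MeasurePreserving (puncturedExt f) (Measure.comap ((↑) : ({0}ᶜ : Set E3) → E3) volume)
      (Measure.comap ((↑) : ({0}ᶜ : Set E3) → E3) volume) := by
  rw [puncturedExt_eq]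
  have h := (volume : Measure E3).measurePreserving_homeomorphUnitSphereProd
  have h1 : MeasurePreserving (Prod.map f id)
      ((volume : Measure E3).toSphere.prod (Measure.volumeIoiPow (Module.finrank ℝ E3 - 1)))
      ((volume : Measure E3).toSphere.prod (Measure.volumeIoiPow (Module.finrank ℝ E3 - 1))) :=
    (measurePreserving_toSphere hf).prod (MeasurePreserving.id _)
  exact (MeasurePreserving.symm (homeomorphUnitSphereProd E3).toMeasurableEquiv h).comp
    (h1.comp h)

theorem volume_image_homExt (f : SphereDiffeo) (hf : MeasurePreserving f area area) {s : Set E3}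
    (hs : MeasurableSet s) (h0 : s ⊆ {0}ᶜ) : volume (homExt f '' s) = volume s := by
  have hf' : MeasurePreserving f.symm area area :=
    MeasurePreserving.symm f.toHomeomorph.toMeasurableEquiv hf
  have hm := measurePreserving_puncturedExt hf'
  have hU : MeasurableSet ({0}ᶜ : Set E3) := (measurableSet_singleton 0).compl
  set t : Set ({0}ᶜ : Set E3) := (↑) ⁻¹' s with ht
  have htm : MeasurableSet t := hs.preimage measurable_subtype_coe
  have h1 := hm.measure_preimage htm.nullMeasurableSet
  rw [comap_subtype_coe_apply hU, comap_subtype_coe_apply hU] at h1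
  have h2 : ((↑) : ({0}ᶜ : Set E3) → E3) '' t = s := by
    rw [ht, Subtype.image_preimage_coe, inter_eq_right]; exact h0
  have h3 : ((↑) : ({0}ᶜ : Set E3) → E3) '' (puncturedExt f.symm ⁻¹' t) = homExt f '' s := by
    ext y
    constructor
    · rintro ⟨z, hz, rfl⟩
      refine ⟨homExt f.symm z, hz, ?_⟩
      exact congrFun (homExt_symm_comp f.symm) z
    · rintro ⟨z, hz, rfl⟩
      refine ⟨⟨homExt f z, homExt_ne_zero f (h0 hz)⟩, ?_, rfl⟩
      change homExt f.symm (homExt f z) ∈ s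
      have := congrFun (homExt_symm_comp f) z
      simp only [Function.comp_apply, id] at this
      rwa [this]
  rw [h2, h3] at h1
  exact h1

/-- The change of variables formula shows that `|det|` integrates to the volume over every
measurable set off the origin, so it equals one almost everywhere; continuity removes the
exceptional set. -/
theorem abs_det_extDeriv (f : SphereDiffeo) (hf : MeasurePreserving f area area) (x : S2) :
    |(extDeriv f x).det| = 1 := by
  have hU : MeasurableSet ({0}ᶜ : Set E3) := (measurableSet_singleton 0).compl
  have hinj : Function.Injective (homExt f) :=
    Function.LeftInverse.injective (g := homExt f.symm) (congrFun (homExt_symm_comp f))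
  have hcont : ContinuousOn (fun y => |(extDeriv f y).det|) {0}ᶜ :=
    (ContinuousLinearMap.continuous_det.comp_continuousOn (continuousOn_extDeriv f)).abs
  have hcont' : ContinuousOn (fun y => ENNReal.ofReal |(extDeriv f y).det|) {0}ᶜ :=
    ENNReal.continuous_ofReal.comp_continuousOn hcont
  have hae : (fun y => ENNReal.ofReal |(extDeriv f y).det|) =ᵐ[volume.restrict ({0}ᶜ : Set E3)]
      fun _ => 1 := by
    have hi : ∀ s, MeasurableSet s → s ⊆ ({0}ᶜ : Set E3) →
        ∫⁻ y in s, ENNReal.ofReal |(extDeriv f y).det| = volume s := by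
      intro s hs h0
      rw [lintegral_abs_det_fderiv_eq_addHaar_image volume hs
        (fun y hy => (hasFDerivAt_homExt f (h0 hy)).hasFDerivWithinAt) hinj.injOn]
      exact volume_image_homExt f hf hs h0
    refine ae_eq_of_forall_setLIntegral_eq_of_sigmaFinite₀ (hcont'.aemeasurable hU)
      aemeasurable_const fun s hs _ => ?_
    rw [Measure.restrict_restrict hs, hi _ (hs.inter hU) inter_subset_right, setLIntegral_const,
      one_mul]
  have := Measure.eqOn_open_of_ae_eq hae isOpen_compl_singleton hcont' continuousOn_const
    (ne_zero_of_mem_unit_sphere x : (x : E3) ∈ ({0}ᶜ : Set E3))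
  simpa using this

/-! ### The first fundamental form -/

theorem unitVec_zero (x : S2) : unitVec x 0 = frameFst x := by simp [unitVec]

theorem unitVec_pi_div_two (x : S2) : unitVec x (Real.pi / 2) = frameSnd x := by simp [unitVec]

theorem norm_unitVec (x : S2) (θ : ℝ) : ‖unitVec x θ‖ = 1 :=
  mem_sphere_zero_iff_norm.1 (unitVec_mem x θ)

theorem norm_frameFst (x : S2) : ‖frameFst x‖ = 1 := by
  rw [← unitVec_zero, norm_unitVec]

theorem norm_frameSnd (x : S2) : ‖frameSnd x‖ = 1 := by
  rw [← unitVec_pi_div_two, norm_unitVec]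

theorem inner_frameFst (x : S2) : ⟪(x : E3), frameFst x⟫ = 0 := by
  rw [← unitVec_zero, inner_unitVec]

theorem inner_frameSnd (x : S2) : ⟪(x : E3), frameSnd x⟫ = 0 := by
  rw [← unitVec_pi_div_two, inner_unitVec]

theorem inner_frameFst_frameSnd (x : S2) : ⟪frameFst x, frameSnd x⟫ = 0 := by
  simp [frameSnd, crossProduct, PiLp.inner_apply, Fin.sum_univ_three]
  ring

/-- The square of the determinant of three vectors is their Gram determinant. -/
theorem det_sq_eq_gram (u v w : E3) :
    ((EuclideanSpace.basisFun (Fin 3) ℝ).toBasis.det ![u, v, w]) ^ 2 =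
      ⟪u, u⟫ * (⟪v, v⟫ * ⟪w, w⟫ - ⟪v, w⟫ ^ 2) - ⟪u, v⟫ * (⟪u, v⟫ * ⟪w, w⟫ - ⟪v, w⟫ * ⟪u, w⟫) +
        ⟪u, w⟫ * (⟪u, v⟫ * ⟪v, w⟫ - ⟪v, v⟫ * ⟪u, w⟫) := by
  simp only [Module.Basis.det_apply, Matrix.det_fin_three, Module.Basis.toMatrix_apply,
    PiLp.inner_apply, Fin.sum_univ_three, OrthonormalBasis.coe_toBasis_repr_apply,
    EuclideanSpace.basisFun_repr, Matrix.cons_val_zero, Matrix.cons_val_one, Matrix.cons_val,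
    RCLike.inner_apply, conj_trivial]
  ring

/-- The extension's differential sends `x` to the unit vector `f x` and `x^⊥` into `(f x)^⊥`. The
radial direction thus splits off the Gram determinant, and `det² = 1` leaves `EG - F² = 1`. -/
theorem gram_extDeriv (f : SphereDiffeo) (hf : MeasurePreserving f area area) (x : S2) :
    ‖extDeriv f x (frameFst x)‖ ^ 2 * ‖extDeriv f x (frameSnd x)‖ ^ 2 -
      ⟪extDeriv f x (frameFst x), extDeriv f x (frameSnd x)⟫ ^ 2 = 1 := by
  set e := (EuclideanSpace.basisFun (Fin 3) ℝ).toBasis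
  have h1 := e.det_comp (extDeriv f x : E3 →ₗ[ℝ] E3) ![(x : E3), frameFst x, frameSnd x]
  have h2 : (extDeriv f x : E3 →ₗ[ℝ] E3) ∘ ![(x : E3), frameFst x, frameSnd x] =
      ![(f x : E3), extDeriv f x (frameFst x), extDeriv f x (frameSnd x)] := by
    funext i
    fin_cases i
    · exact extDeriv_self f x
    · rfl
    · rfl
  have h3 : (LinearMap.det (extDeriv f x : E3 →ₗ[ℝ] E3)) ^ 2 = 1 := by
    rw [← sq_abs]
    have := abs_det_extDeriv f hf x
    rw [ContinuousLinearMap.det] at this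
    rw [this, one_pow]
  have h4 := congrArg (· ^ 2) h1
  simp only [mul_pow] at h4
  rw [h2, h3, one_mul, det_sq_eq_gram, det_sq_eq_gram, inner_extDeriv f x (inner_frameFst x),
    inner_extDeriv f x (inner_frameSnd x), inner_frameFst, inner_frameSnd,
    inner_frameFst_frameSnd] at h4
  simp only [real_inner_self_eq_norm_sq, norm_frameFst, norm_frameSnd, norm_eq_of_mem_sphere] at h4
  linarith

theorem norm_extDeriv_unitVec_sq (f : SphereDiffeo) (x : S2) (θ : ℝ) :
    ‖extDeriv f x (unitVec x θ)‖ ^ 2 =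
      ‖extDeriv f x (frameFst x)‖ ^ 2 * Real.cos θ ^ 2 +
      2 * ⟪extDeriv f x (frameFst x), extDeriv f x (frameSnd x)⟫ * (Real.cos θ * Real.sin θ) +
      ‖extDeriv f x (frameSnd x)‖ ^ 2 * Real.sin θ ^ 2 := by
  rw [unitVec, map_add, map_smul, map_smul, norm_add_sq_real, norm_smul, norm_smul,
    inner_smul_left, inner_smul_right, mul_pow, mul_pow, Real.norm_eq_abs, Real.norm_eq_abs,
    sq_abs, sq_abs]
  simp only [conj_trivial]
  ring

theorem orthonormal_of_inner {u v w : E3} (hu : ‖u‖ = 1) (hv : ‖v‖ = 1) (hw : ‖w‖ = 1)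
    (huv : ⟪u, v⟫ = 0) (huw : ⟪u, w⟫ = 0) (hvw : ⟪v, w⟫ = 0) : Orthonormal ℝ ![u, v, w] := by
  constructor
  · intro i
    fin_cases i <;> simp [hu, hv, hw]
  · intro i j hij
    fin_cases i <;> fin_cases j <;> first
      | exact absurd rfl hij
      | simp [huv, huw, hvw, real_inner_comm u, real_inner_comm v]

/-- If the tangent map at `x` sends the frame to orthonormal vectors then the differential of the
homogeneous extension is isometric. -/
theorem norm_extDeriv_of_orthonormal (f : SphereDiffeo) (x : S2)
    (hE : ‖extDeriv f x (frameFst x)‖ = 1) (hG : ‖extDeriv f x (frameSnd x)‖ = 1)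
    (hF : ⟪extDeriv f x (frameFst x), extDeriv f x (frameSnd x)⟫ = 0) (v : E3) :
    ‖extDeriv f x v‖ = ‖v‖ := by
  have ho := orthonormal_of_inner (norm_eq_of_mem_sphere x) (norm_frameFst x) (norm_frameSnd x)
    (inner_frameFst x) (inner_frameSnd x) (inner_frameFst_frameSnd x)
  have ho' := orthonormal_of_inner (norm_eq_of_mem_sphere (f x)) hE hG
    (inner_extDeriv f x (inner_frameFst x)) (inner_extDeriv f x (inner_frameSnd x)) hF
  have hcard : Fintype.card (Fin 3) = Module.finrank ℝ E3 := by simp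
  let b := basisOfOrthonormalOfCardEqFinrank ho hcard
  have hb : ⇑b = ![(x : E3), frameFst x, frameSnd x] :=
    coe_basisOfOrthonormalOfCardEqFinrank ho hcard
  have h2 : (extDeriv f x : E3 →ₗ[ℝ] E3) ∘ b =
      ![(f x : E3), extDeriv f x (frameFst x), extDeriv f x (frameSnd x)] := by
    rw [hb]
    funext i
    fin_cases i
    · exact extDeriv_self f x
    · rfl
    · rfl
  exact ((extDeriv f x : E3 →ₗ[ℝ] E3).isometryOfOrthonormal (v := b) (by rwa [hb])
    (by rwa [h2])).norm_map v

/-! ### Diffeomorphisms with isometric tangent maps are isometries -/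

theorem zero_notMem_segment {x y : S2} (h : (x : E3) ≠ -y) :
    (0 : E3) ∉ segment ℝ (x : E3) (y : E3) := by
  rintro ⟨s, t, hs, ht, hst, h0⟩
  have h1 : s • (x : E3) = -(t • (y : E3)) := eq_neg_of_add_eq_zero_left h0
  have h2 := congrArg norm h1
  rw [norm_neg, norm_smul, norm_smul, norm_eq_of_mem_sphere, norm_eq_of_mem_sphere, mul_one,
    mul_one, Real.norm_of_nonneg hs, Real.norm_of_nonneg ht] at h2
  subst h2
  have h3 : s ≠ 0 := by rintro rfl; norm_num at hst
  rw [← smul_neg] at h1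
  exact h (smul_right_injective _ h3 h1)

/-- The mean value inequality is applied to the extension along the chord from `x` to `y`, where its
differential has norm at most one. The chord meets the origin only for antipodal points, whose
distance is already the diameter. -/
theorem dist_le_of_norm_extDeriv_le (f : SphereDiffeo)
    (h : ∀ (x : S2) (v : E3), ‖extDeriv f x v‖ ≤ ‖v‖) (x y : S2) :
    dist (f x) (f y) ≤ dist x y := by
  rw [Subtype.dist_eq, Subtype.dist_eq]
  by_cases hxy : (x : E3) = -y
  · have h1 : dist (x : E3) y = 2 := by
      rw [hxy, dist_eq_norm, ← neg_add', norm_neg, ← two_smul ℝ, norm_smul]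
      simp
    rw [h1]
    refine (dist_le_norm_add_norm _ _).trans ?_
    simp
    norm_num
  · have hne : ∀ z ∈ segment ℝ (x : E3) (y : E3), z ≠ 0 := fun z hz h0 =>
      zero_notMem_segment hxy (h0 ▸ hz)
    have := (convex_segment (𝕜 := ℝ) (x : E3) (y : E3)).norm_image_sub_le_of_norm_hasFDerivWithin_le
      (f := homExt f) (f' := extDeriv f) (C := 1)
      (fun z hz => (hasFDerivAt_homExt f (hne z hz)).hasFDerivWithinAt)
      (fun z hz => by
        obtain ⟨r, hr, w, rfl⟩ := exists_eq_smul_coe (hne z hz)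
        rw [extDeriv_smul f hr]
        exact ContinuousLinearMap.opNorm_le_bound _ zero_le_one fun v => by
          rw [one_mul]; exact h w v)
      (right_mem_segment ℝ _ _) (left_mem_segment ℝ _ _)
    rwa [homExt_coe, homExt_coe, one_mul, ← dist_eq_norm, ← dist_eq_norm] at this

theorem isometry_of_norm_extDeriv (f : SphereDiffeo)
    (h : ∀ (x : S2) (v : E3), ‖extDeriv f x v‖ = ‖v‖) : Isometry f := by
  refine Isometry.of_dist_eq fun x y => ?_
  refine le_antisymm (dist_le_of_norm_extDeriv_le f (fun x v => (h x v).le) x y) ?_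
  have h' : ∀ (x : S2) (v : E3), ‖extDeriv f.symm x v‖ ≤ ‖v‖ := by
    intro x v
    have h1 := extDeriv_symm_apply f.symm x v
    have h2 := h (f.symm x) (extDeriv f.symm x v)
    rw [← h2]
    exact (congrArg norm h1).le
  simpa using dist_le_of_norm_extDeriv_le f.symm h' (f x) (f y)

/-! ### Averaging the logarithm of a quadratic form over the circle -/

/-- Jensen's formula: `z² - c²` factors, and `log ‖z ∓ c‖` has mean zero over the unit circle when
the root lies inside the disc. -/
theorem circleAverage_log_norm_sq_sub {c : ℂ} (hc : ‖c‖ < 1) :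
    Real.circleAverage (fun z => Real.log ‖z ^ 2 - c ^ 2‖) 0 1 = 0 := by
  have h : EqOn (fun z => Real.log ‖z ^ 2 - c ^ 2‖)
      ((fun z => Real.log ‖z - c‖) + fun z => Real.log ‖z - (-c)‖) (Metric.sphere 0 |1|) := by
    intro z hz
    have hz' : ‖z‖ = 1 := by simpa using hz
    have h1 : z - c ≠ 0 := fun h => by
      rw [sub_eq_zero.1 h] at hz'; linarith
    have h2 : z - -c ≠ 0 := fun h => by
      rw [sub_eq_zero.1 h, norm_neg] at hz'; linarith
    simp only [Pi.add_apply]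
    rw [← Real.log_mul (norm_ne_zero_iff.2 h1) (norm_ne_zero_iff.2 h2), ← norm_mul]
    congr 2
    ring
  rw [Real.circleAverage_congr_sphere h, Real.circleAverage_add
    (circleIntegrable_log_norm_sub_const 1) (circleIntegrable_log_norm_sub_const 1),
    circleAverage_log_norm_sub_const₀ hc, circleAverage_log_norm_sub_const₀ (by simpa using hc),
    add_zero]

/-- The circular mean of `log (E cos² + 2 F cos sin + G sin²)`, for a form of determinant one. -/
theorem average_log_quadratic {E F G : ℝ} (hE : 0 < E) (h : E * G - F ^ 2 = 1) :
    (2 * Real.pi)⁻¹ * ∫ θ in (0 : ℝ)..2 * Real.pi,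
      Real.log (E * Real.cos θ ^ 2 + 2 * F * (Real.cos θ * Real.sin θ) + G * Real.sin θ ^ 2) =
    Real.log ((E + G + 2) / 4) := by
  set s := Real.sqrt E with hs
  have hs0 : 0 < s := Real.sqrt_pos.2 hE
  have hsE : s ^ 2 = E := Real.sq_sqrt hE.le
  -- With `p = √E` and `q = (F + i) / √E` the form is `|p cos θ + q sin θ|²`, since `EG - F² = 1`.
  -- For `z = e^{iθ}` the vector inside is `α z + β z̄`, and multiplying by `z` gives `α z² + β = α
  -- (z² - c²)` with `c² = -β / α`. As `|α|² - |β|² = 1`, the roots lie inside the disc and only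
  -- `log |α|²` survives averaging.
  let p : ℂ := ⟨s, 0⟩
  let q : ℂ := ⟨F / s, 1 / s⟩
  let α : ℂ := (p - Complex.I * q) / 2
  let β : ℂ := (p + Complex.I * q) / 2
  have hG : G = (1 + F ^ 2) / s ^ 2 := by rw [hsE]; field_simp; linarith
  have hα : ‖α‖ ^ 2 = (E + G + 2) / 4 := by
    rw [Complex.sq_norm, Complex.normSq_apply, hG, ← hsE]
    simp [α, p, q]
    field_simp
    ring
  have hβ : ‖β‖ ^ 2 = (E + G - 2) / 4 := by
    rw [Complex.sq_norm, Complex.normSq_apply, hG, ← hsE]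
    simp [β, p, q]
    field_simp
    ring
  have hαβ : ‖β‖ < ‖α‖ := by
    refine lt_of_pow_lt_pow_left₀ 2 (norm_nonneg _) ?_
    rw [hα, hβ]; linarith
  have hα0 : 0 < ‖α‖ := (norm_nonneg _).trans_lt hαβ
  obtain ⟨c, hc⟩ := IsAlgClosed.exists_pow_nat_eq (-β / α) (n := 2) two_pos
  have hc1 : ‖c‖ < 1 := by
    have : ‖c‖ ^ 2 < 1 := by
      rw [← norm_pow, hc, norm_div, norm_neg, div_lt_one hα0]; exact hαβ
    nlinarith [norm_nonneg c]
  have hmul : α * (-β / α) = -β := by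
    field_simp [norm_pos_iff.1 hα0]
  have key : ∀ θ : ℝ,
      Real.log (E * Real.cos θ ^ 2 + 2 * F * (Real.cos θ * Real.sin θ) + G * Real.sin θ ^ 2) =
      Real.log (‖α‖ ^ 2) + 2 * Real.log ‖(circleMap 0 1 θ) ^ 2 - c ^ 2‖ := by
    intro θ
    have hz : circleMap 0 1 θ = ⟨Real.cos θ, Real.sin θ⟩ := by
      apply Complex.ext <;> simp [circleMap, Complex.exp_ofReal_mul_I_re,
        Complex.exp_ofReal_mul_I_im]
    have hzn : ‖circleMap 0 1 θ‖ = 1 := by simp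
    have hne : (circleMap 0 1 θ) ^ 2 - c ^ 2 ≠ 0 := fun h0 => by
      have := congrArg norm (sub_eq_zero.1 h0)
      rw [norm_pow, norm_pow, hzn] at this
      nlinarith [norm_nonneg c]
    have h1 : E * Real.cos θ ^ 2 + 2 * F * (Real.cos θ * Real.sin θ) + G * Real.sin θ ^ 2 =
        ‖α‖ ^ 2 * ‖(circleMap 0 1 θ) ^ 2 - c ^ 2‖ ^ 2 := by
      have h2 : E * Real.cos θ ^ 2 + 2 * F * (Real.cos θ * Real.sin θ) + G * Real.sin θ ^ 2 =
          ‖(Real.cos θ : ℂ) * p + (Real.sin θ : ℂ) * q‖ ^ 2 := by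
        rw [Complex.sq_norm, Complex.normSq_apply, hG, ← hsE]
        simp only [p, q, Complex.add_re, Complex.add_im, Complex.re_ofReal_mul,
          Complex.im_ofReal_mul]
        field_simp
        ring
      have h3 : (circleMap 0 1 θ) * ((Real.cos θ : ℂ) * p + (Real.sin θ : ℂ) * q) =
          α * ((circleMap 0 1 θ) ^ 2 - c ^ 2) := by
        have hcs : (Real.cos θ : ℂ) ^ 2 + (Real.sin θ : ℂ) ^ 2 = 1 := by
          exact_mod_cast Real.cos_sq_add_sin_sq θ
        have hz' : circleMap 0 1 θ = (Real.cos θ : ℂ) + (Real.sin θ : ℂ) * Complex.I := by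
          rw [hz]; apply Complex.ext <;> simp [-Complex.ofReal_cos, -Complex.ofReal_sin]
        rw [mul_sub, hc, hmul, hz']
        simp only [α, β]
        linear_combination ((p + Complex.I * q) / 2) * hcs -
          ((Real.sin θ : ℂ) ^ 2 * p / 2 - Real.cos θ * Real.sin θ * q -
            (Real.sin θ : ℂ) ^ 2 * Complex.I * q / 2) * Complex.I_sq
      rw [h2, ← mul_pow, ← norm_mul, ← h3, norm_mul, hzn, one_mul]
    rw [h1, Real.log_mul (by positivity) (by simpa using hne), Real.log_pow (n := 2) ‖_ - _‖]
    norm_num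
  have h0 := circleAverage_log_norm_sq_sub hc1
  rw [Real.circleAverage_def, smul_eq_mul] at h0
  have hpi : (2 * Real.pi)⁻¹ ≠ 0 := by positivity
  have hI : IntervalIntegrable (fun θ => Real.log ‖(circleMap 0 1 θ) ^ 2 - c ^ 2‖) volume 0
      (2 * Real.pi) := by
    refine Continuous.intervalIntegrable ?_ _ _
    refine Continuous.log (by fun_prop) fun θ h0 => ?_
    have := congrArg norm (sub_eq_zero.1 (norm_eq_zero.1 h0))
    rw [norm_pow, norm_pow] at this
    simp at this
    nlinarith [norm_nonneg c]
  simp_rw [key]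
  rw [intervalIntegral.integral_add (by simp) (hI.const_mul 2),
    intervalIntegral.integral_const_mul, (mul_eq_zero.1 h0).resolve_left hpi, ← hα]
  simp
  field_simp

/-! ### Rotations of the unit tangent bundle -/

/-- A rotation as a linear isometry of `ℝ³`. -/
def rotIso (g : SO3) : E3 ≃ₗᵢ[ℝ] E3 where
  toFun := rotLin g
  invFun := rotLin g⁻¹
  map_add' := map_add _
  map_smul' := map_smul _
  left_inv y := by rw [← rotLin_mul, inv_mul_cancel, rotLin_one]
  right_inv y := by rw [← rotLin_mul, mul_inv_cancel, rotLin_one]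
  norm_map' := norm_rotLin g

theorem inner_rotLin (g : SO3) (u v : E3) : ⟪rotLin g u, rotLin g v⟫ = ⟪u, v⟫ :=
  (rotIso g).inner_map_map u v

theorem continuous_rotLin_apply : Continuous fun q : SO3 × E3 => rotLin q.1 q.2 := by
  have hrot : Continuous rotLin :=
    (LinearMap.continuous_of_finiteDimensional
      (Matrix.toEuclideanCLM (n := Fin 3) (𝕜 := ℝ)).toAlgEquiv.toLinearMap).comp
      continuous_subtype_val
  exact (hrot.comp continuous_fst).clm_apply continuous_snd

-- The area of `s` is a multiple of the volume of the cone over `s`, and rotations are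
-- volume-preserving isometries of `ℝ³` that carry cones to cones.
open scoped Pointwise in
theorem measurePreserving_rotFun (g : SO3) : MeasurePreserving (rotFun g) area area := by
  have hm : Measurable (rotFun g) := (rot g).continuous.measurable
  refine measurePreserving_area ⟨hm, ?_⟩
  ext s hs
  rw [Measure.map_apply hm hs, Measure.toSphere_apply' _ hs, Measure.toSphere_apply' _ (hm hs)]
  congr 1
  have hm' := (rotIso g).measurePreserving.measure_preimage_equiv
    (f := (rotIso g).toHomeomorph.toMeasurableEquiv) 
    (Ioo (0 : ℝ) 1 • ((↑) '' s : Set E3))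
  rw [← hm']
  congr 1
  ext y
  constructor
  · rintro ⟨r, hr, _, ⟨x, hx, rfl⟩, rfl⟩
    exact ⟨r, hr, _, ⟨rotFun g x, hx, rfl⟩, ((rotIso g).map_smul r x).symm⟩
  · rintro ⟨r, hr, _, ⟨x, hx, rfl⟩, h⟩
    refine ⟨r, hr, _, ⟨rotFun g⁻¹ x, ?_, rfl⟩, ?_⟩
    · rwa [mem_preimage, show rotFun g (rotFun g⁻¹ x) = x from (rot g).right_inv x]
    · apply (rotIso g).injective
      refine Eq.trans ?_ h
      change rotIso g (r • rotLin g⁻¹ x) = r • (x : E3)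
      rw [(rotIso g).map_smul]
      exact congrArg (r • ·) ((rotIso g).right_inv x)

/-- The action of a rotation on unit tangent vectors. -/
def rotTangent (g : SO3) (p : UnitTangent) : UnitTangent :=
  ⟨(rotFun g p.1.1, rotFun g p.1.2), (inner_rotLin g _ _).trans p.2⟩

theorem rotTangent_mul (g k : SO3) (p : UnitTangent) :
    rotTangent (g * k) p = rotTangent g (rotTangent k p) :=
  Subtype.ext (Prod.ext (Subtype.ext (rotLin_mul g k _)) (Subtype.ext (rotLin_mul g k _)))

theorem continuous_rotTangent : Continuous fun q : SO3 × UnitTangent => rotTangent q.1 q.2 := by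
  refine Continuous.subtype_mk (Continuous.prodMk ?_ ?_) _
  · exact Continuous.subtype_mk (continuous_rotLin_apply.comp
      (by fun_prop : Continuous fun q : SO3 × UnitTangent => (q.1, (q.2.1.1 : E3)))) _
  · exact Continuous.subtype_mk (continuous_rotLin_apply.comp
      (by fun_prop : Continuous fun q : SO3 × UnitTangent => (q.1, (q.2.1.2 : E3)))) _

/-- The vector product in `ℝ³`. -/
def cross (u v : E3) : E3 := WithLp.toLp 2 (crossProduct (WithLp.ofLp u) (WithLp.ofLp v))

theorem frameSnd_eq_cross (x : S2) : frameSnd x = cross x (frameFst x) := rfl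

theorem cross_apply_zero (u v : E3) : cross u v 0 = u 1 * v 2 - u 2 * v 1 := by
  simp [cross, cross_apply]

theorem cross_apply_one (u v : E3) : cross u v 1 = u 2 * v 0 - u 0 * v 2 := by
  simp [cross, cross_apply]

theorem cross_apply_two (u v : E3) : cross u v 2 = u 0 * v 1 - u 1 * v 0 := by
  simp [cross, cross_apply]

theorem real_inner_eq (u v : E3) : ⟪u, v⟫ = u 0 * v 0 + u 1 * v 1 + u 2 * v 2 := by
  simp [PiLp.inner_apply, Fin.sum_univ_three]
  ring

theorem rotLin_apply (g : SO3) (u : E3) (i : Fin 3) :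
    rotLin g u i = (g : Matrix (Fin 3) (Fin 3) ℝ) i 0 * u 0 +
      (g : Matrix (Fin 3) (Fin 3) ℝ) i 1 * u 1 + (g : Matrix (Fin 3) (Fin 3) ℝ) i 2 * u 2 := by
  simp [rotLin, Matrix.mulVec, dotProduct, Fin.sum_univ_three]

/-- Paired with a third vector, the cross product is a determinant, which `det g = 1` leaves
unchanged; the vectors `rotLin g w` exhaust `ℝ³`. -/
theorem rotLin_cross (g : SO3) (u v : E3) :
    rotLin g (cross u v) = cross (rotLin g u) (rotLin g v) := by
  have key : ∀ w : E3, ⟪rotLin g w, rotLin g (cross u v)⟫ =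
      ⟪rotLin g w, cross (rotLin g u) (rotLin g v)⟫ := by
    intro w
    have hd : (g : Matrix (Fin 3) (Fin 3) ℝ).det = 1 :=
      (Matrix.mem_specialOrthogonalGroup_iff.1 g.2).2
    rw [Matrix.det_fin_three] at hd
    rw [inner_rotLin, real_inner_eq, real_inner_eq]
    simp only [cross_apply_zero, cross_apply_one, cross_apply_two, rotLin_apply]
    linear_combination (-(w 0 * (u 1 * v 2 - u 2 * v 1) + w 1 * (u 2 * v 0 - u 0 * v 2) +
      w 2 * (u 0 * v 1 - u 1 * v 0))) * hd
  refine ext_inner_left ℝ fun w => ?_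
  have := key (rotLin g⁻¹ w)
  rwa [← rotLin_mul, mul_inv_cancel, rotLin_one] at this

theorem cross_cross_of_orthogonal {u v : E3} (hu : ‖u‖ = 1) (huv : ⟪u, v⟫ = 0) :
    cross u (cross u v) = -v := by
  have h1 : ⟪u, u⟫ = 1 := by rw [real_inner_self_eq_norm_sq, hu, one_pow]
  rw [real_inner_eq] at h1 huv
  ext i
  fin_cases i
  all_goals
    simp only [Fin.zero_eta, Fin.mk_one, Fin.reduceFinMk, PiLp.neg_apply, cross_apply_zero,
      cross_apply_one, cross_apply_two]
  · linear_combination u 0 * huv - v 0 * h1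
  · linear_combination u 1 * huv - v 1 * h1
  · linear_combination u 2 * huv - v 2 * h1

theorem cross_add_smul (u v w : E3) (r s : ℝ) :
    cross u (r • v + s • w) = r • cross u v + s • cross u w := by
  simp [cross]

/-- The unit vectors `unitVec x θ` exhaust the unit circle of the tangent plane at `x`. -/
theorem exists_unitVec_eq (x : S2) {v : E3} (hv : ‖v‖ = 1) (hxv : ⟪(x : E3), v⟫ = 0) :
    ∃ θ : ℝ, v = unitVec x θ := by
  have ho := orthonormal_of_inner (norm_eq_of_mem_sphere x) (norm_frameFst x) (norm_frameSnd x)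
    (inner_frameFst x) (inner_frameSnd x) (inner_frameFst_frameSnd x)
  have hcard : Fintype.card (Fin 3) = Module.finrank ℝ E3 := by simp
  let b := (basisOfOrthonormalOfCardEqFinrank ho hcard).toOrthonormalBasis
    (by rwa [coe_basisOfOrthonormalOfCardEqFinrank])
  have hb : ⇑b = ![(x : E3), frameFst x, frameSnd x] := by
    simp [b, coe_basisOfOrthonormalOfCardEqFinrank]
  have h1 : v = ⟪frameFst x, v⟫ • frameFst x + ⟪frameSnd x, v⟫ • frameSnd x := by
    have := b.sum_repr' v
    rw [Fin.sum_univ_three, hb] at this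
    simp only [Matrix.cons_val_zero, Matrix.cons_val_one, Matrix.cons_val, hxv, zero_smul,
      zero_add] at this
    exact this.symm
  have h2 : ⟪frameFst x, v⟫ ^ 2 + ⟪frameSnd x, v⟫ ^ 2 = 1 := by
    have := b.sum_sq_norm_inner_right v
    rw [Fin.sum_univ_three, hb, hv] at this
    simpa [hxv] using this
  have h3 : ‖(⟨⟪frameFst x, v⟫, ⟪frameSnd x, v⟫⟩ : ℂ)‖ = 1 := by
    rw [← sq_eq_sq₀ (norm_nonneg _) zero_le_one, Complex.sq_norm, Complex.normSq_apply]
    simp only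
    nlinarith
  refine ⟨Complex.arg ⟨⟪frameFst x, v⟫, ⟪frameSnd x, v⟫⟩, ?_⟩
  have hc := Complex.norm_mul_cos_arg ⟨⟪frameFst x, v⟫, ⟪frameSnd x, v⟫⟩
  have hs := Complex.norm_mul_sin_arg ⟨⟪frameFst x, v⟫, ⟪frameSnd x, v⟫⟩
  rw [h3, one_mul] at hc hs
  rw [unitVec, hc, hs]
  exact h1

/-- Rotations act on the fibres by shifting the angle. -/
theorem exists_rotTangent_unitTangentOf (g : SO3) (x : S2) :
    ∃ α : ℝ, ∀ θ : ℝ, rotTangent g (unitTangentOf (x, θ)) = unitTangentOf (rotFun g x, α + θ) := by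
  obtain ⟨α, hα⟩ := exists_unitVec_eq (rotFun g x) (v := rotLin g (frameFst x))
    (by rw [norm_rotLin, norm_frameFst]) ((inner_rotLin g _ _).trans (inner_frameFst x))
  refine ⟨α, fun θ => Subtype.ext (Prod.ext rfl (Subtype.ext ?_))⟩
  change rotLin g (unitVec x θ) = unitVec (rotFun g x) (α + θ)
  -- The image of the second frame vector is forced, being a cross product; orientation makes the
  -- fibre map a shift and not a reflection.
  have h2 : rotLin g (frameSnd x) = Real.cos α • frameSnd (rotFun g x) -
      Real.sin α • frameFst (rotFun g x) := by
    rw [frameSnd_eq_cross x, rotLin_cross, hα, unitVec, cross_add_smul]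
    change Real.cos α • cross (rotFun g x) (frameFst (rotFun g x)) +
      Real.sin α • cross (rotFun g x) (cross (rotFun g x) (frameFst (rotFun g x))) = _
    rw [cross_cross_of_orthogonal (norm_eq_of_mem_sphere _) (inner_frameFst _), smul_neg,
      ← sub_eq_add_neg]
    rfl
  rw [unitVec, map_add, map_smul, map_smul, h2, hα, unitVec, unitVec, Real.cos_add, Real.sin_add]
  module

/-! ### Invariance of Liouville measure -/

theorem measurable_coe_apply (i : Fin 3) : Measurable fun x : S2 => (x : E3) i := by
  have : Continuous fun x : S2 => (x : E3) i := by fun_prop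
  exact this.measurable

theorem measurable_frameFst : Measurable frameFst := by
  have h0 := measurable_coe_apply 0
  have h1 := measurable_coe_apply 1
  refine Measurable.ite (measurableSet_eq_fun (by fun_prop) measurable_const) measurable_const ?_
  have hr : Measurable fun x : S2 => (Real.sqrt ((x : E3) 0 ^ 2 + (x : E3) 1 ^ 2))⁻¹ := by fun_prop
  refine hr.smul ?_
  refine (WithLp.measurable_toLp 2 _).comp (measurable_pi_lambda _ fun i => ?_)
  fin_cases i
  · exact h1.neg
  · exact h0
  · exact measurable_const

theorem measurable_frameFst_apply (i : Fin 3) : Measurable fun x : S2 => frameFst x i :=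
  (by fun_prop : Continuous fun y : E3 => y i).measurable.comp measurable_frameFst

theorem measurable_frameSnd : Measurable frameSnd := by
  have h := measurable_coe_apply
  have h' := measurable_frameFst_apply
  refine (WithLp.measurable_toLp 2 _).comp (measurable_pi_lambda _ fun i => ?_)
  fin_cases i
  · change Measurable fun x : S2 => cross x (frameFst x) 0
    simp only [cross_apply_zero]
    exact ((h 1).mul (h' 2)).sub ((h 2).mul (h' 1))
  · change Measurable fun x : S2 => cross x (frameFst x) 1
    simp only [cross_apply_one]
    exact ((h 2).mul (h' 0)).sub ((h 0).mul (h' 2))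
  · change Measurable fun x : S2 => cross x (frameFst x) 2
    simp only [cross_apply_two]
    exact ((h 0).mul (h' 1)).sub ((h 1).mul (h' 0))

theorem measurable_unitTangentOf : Measurable unitTangentOf := by
  have h1 : Measurable fun q : S2 × ℝ => unitVec q.1 q.2 :=
    ((Real.measurable_cos.comp measurable_snd).smul (measurable_frameFst.comp measurable_fst)).add
      ((Real.measurable_sin.comp measurable_snd).smul (measurable_frameSnd.comp measurable_fst))
  exact (measurable_fst.prodMk h1.subtype_mk).subtype_mk

/-- The uniform probability measure on the interval of angles. -/
def angleMeasure : Measure ℝ := ProbabilityTheory.cond volume (Ioc 0 (2 * Real.pi))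

instance : IsProbabilityMeasure angleMeasure :=
  ProbabilityTheory.cond_isProbabilityMeasure_of_finite (by simp [Real.pi_pos])
    measure_Ioc_lt_top.ne

theorem liouvilleUnit_eq : liouvilleUnit = (area.prod angleMeasure).map unitTangentOf := rfl

instance : IsProbabilityMeasure liouvilleUnit := by
  rw [liouvilleUnit_eq]
  exact Measure.isProbabilityMeasure_map measurable_unitTangentOf.aemeasurable

theorem lintegral_liouvilleUnit {φ : UnitTangent → ENNReal} (hφ : Measurable φ) :
    ∫⁻ p, φ p ∂liouvilleUnit = ∫⁻ x, ∫⁻ θ, φ (unitTangentOf (x, θ)) ∂angleMeasure ∂area := by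
  rw [liouvilleUnit_eq, lintegral_map hφ measurable_unitTangentOf]
  exact lintegral_prod _ (hφ.comp measurable_unitTangentOf).aemeasurable

theorem unitTangentOf_add_two_pi (x : S2) (n : ℤ) (θ : ℝ) :
    unitTangentOf (x, n * (2 * Real.pi) + θ) = unitTangentOf (x, θ) := by
  refine Subtype.ext (Prod.ext rfl (Subtype.ext ?_))
  simp only [unitTangentOf, unitVec]
  rw [add_comm _ θ, Real.cos_add_int_mul_two_pi, Real.sin_add_int_mul_two_pi]

/-- Any two intervals of length `2π` are fundamental domains for the periods of the angle. -/
theorem lintegral_angleMeasure_add (x : S2) (φ : UnitTangent → ENNReal) (α : ℝ) :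
    ∫⁻ θ, φ (unitTangentOf (x, α + θ)) ∂angleMeasure =
      ∫⁻ θ, φ (unitTangentOf (x, θ)) ∂angleMeasure := by
  rw [angleMeasure, ProbabilityTheory.cond, lintegral_smul_measure, lintegral_smul_measure]
  congr 1
  have hpi : (0 : ℝ) < 2 * Real.pi := by positivity
  have h1 : ∫⁻ θ in Ioc 0 (2 * Real.pi), φ (unitTangentOf (x, α + θ)) =
      ∫⁻ θ in Ioc α (α + 2 * Real.pi), φ (unitTangentOf (x, θ)) := by
    have := (measurePreserving_add_left (volume : Measure ℝ) α).setLIntegral_comp_preimage_emb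
      (measurableEmbedding_addLeft α) (fun θ => φ (unitTangentOf (x, θ)))
      (Ioc α (α + 2 * Real.pi))
    rw [← this]
    simp
  have h2 := (isAddFundamentalDomain_Ioc hpi 0 volume).setLIntegral_eq
    (isAddFundamentalDomain_Ioc hpi α volume) (fun θ => φ (unitTangentOf (x, θ))) (by
      rintro ⟨_, n, rfl⟩ θ
      change φ (unitTangentOf (x, n • (2 * Real.pi) + θ)) = _
      rw [zsmul_eq_mul, unitTangentOf_add_two_pi])
  rw [zero_add] at h2
  rw [h1, h2]

theorem measurable_rotTangent (g : SO3) : Measurable (rotTangent g) :=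
  (continuous_rotTangent.comp (Continuous.prodMk_right g)).measurable

/-- A rotation preserves area on the base and shifts the angle in each fibre, by an amount depending
on the base point. -/
theorem measurePreserving_rotTangent (g : SO3) :
    MeasurePreserving (rotTangent g) liouvilleUnit liouvilleUnit := by
  refine ⟨measurable_rotTangent g, Measure.ext_of_lintegral _ fun φ hφ => ?_⟩
  rw [lintegral_map hφ (measurable_rotTangent g), lintegral_liouvilleUnit hφ]
  refine (lintegral_liouvilleUnit (hφ.comp (measurable_rotTangent g))).trans ?_
  simp only [Function.comp_apply]
  have h1 : ∀ x, ∫⁻ θ, φ (rotTangent g (unitTangentOf (x, θ))) ∂angleMeasure =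
      ∫⁻ θ, φ (unitTangentOf (rotFun g x, θ)) ∂angleMeasure := by
    intro x
    obtain ⟨α, hα⟩ := exists_rotTangent_unitTangentOf g x
    simp_rw [hα]
    exact lintegral_angleMeasure_add _ φ α
  simp_rw [h1]
  exact (measurePreserving_rotFun g).lintegral_comp
    (f := fun y => ∫⁻ θ, φ (unitTangentOf (y, θ)) ∂angleMeasure)
    (hφ.comp measurable_unitTangentOf).lintegral_prod_right'

/-! ### Liouville measure is the image of Haar measure -/

/-- A right translate of Haar measure is again a left Haar probability measure, and there is only
one. -/
theorem map_mul_right_haarSO3 (k : SO3) : haarSO3.map (· * k) = haarSO3 := by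
  have : haarSO3.IsHaarMeasure := by unfold haarSO3; infer_instance
  have : IsProbabilityMeasure (haarSO3.map (· * k)) :=
    Measure.isProbabilityMeasure_map (measurable_mul_const k).aemeasurable
  exact Measure.isHaarMeasure_eq_of_isProbabilityMeasure _ _

/-- The unit tangent vector with base point and direction the first two coordinate vectors. -/
def originTangent : UnitTangent :=
  ⟨(⟨!₂[1, 0, 0], by simp [EuclideanSpace.norm_eq, Fin.sum_univ_three]⟩,
    ⟨!₂[0, 1, 0], by simp [EuclideanSpace.norm_eq, Fin.sum_univ_three]⟩),
    by simp [PiLp.inner_apply, Fin.sum_univ_three]⟩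

theorem exists_rotTangent_originTangent (p : UnitTangent) :
    ∃ g : SO3, p = rotTangent g originTangent := by
  obtain ⟨⟨⟨u, hu⟩, ⟨v, hv⟩⟩, huv⟩ := p
  have hu1 : u 0 ^ 2 + u 1 ^ 2 + u 2 ^ 2 = 1 := sq_sum ⟨u, hu⟩
  have hv1 : v 0 ^ 2 + v 1 ^ 2 + v 2 ^ 2 = 1 := sq_sum ⟨v, hv⟩
  have huv1 : u 0 * v 0 + u 1 * v 1 + u 2 * v 2 = 0 := (real_inner_eq u v).symm.trans huv
  -- The columns are `u`, `v` and `u × v`.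
  let M : Matrix (Fin 3) (Fin 3) ℝ := !![u 0, v 0, u 1 * v 2 - u 2 * v 1;
    u 1, v 1, u 2 * v 0 - u 0 * v 2; u 2, v 2, u 0 * v 1 - u 1 * v 0]
  have hL : (u 1 * v 2 - u 2 * v 1) ^ 2 + (u 2 * v 0 - u 0 * v 2) ^ 2 +
      (u 0 * v 1 - u 1 * v 0) ^ 2 = 1 := by
    linear_combination (v 0 ^ 2 + v 1 ^ 2 + v 2 ^ 2) * hu1 + hv1 -
      (u 0 * v 0 + u 1 * v 1 + u 2 * v 2) * huv1
  have hM : M ∈ Matrix.specialOrthogonalGroup (Fin 3) ℝ := by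
    rw [Matrix.mem_specialOrthogonalGroup_iff, Matrix.mem_orthogonalGroup_iff']
    constructor
    · ext i j
      fin_cases i <;> fin_cases j <;>
        simp [M, Matrix.mul_apply, Fin.sum_univ_three] <;>
        first
          | ring1
          | linear_combination hu1
          | linear_combination hv1
          | linear_combination huv1
          | linear_combination -huv1
          | linear_combination hL
    · rw [Matrix.det_fin_three]
      simp [M]
      linear_combination hL
  refine ⟨⟨M, hM⟩, Subtype.ext (Prod.ext (Subtype.ext ?_) (Subtype.ext ?_))⟩
  · ext i
    change u i = rotLin _ _ i
    rw [rotLin_apply]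
    fin_cases i <;> simp [M, originTangent]
  · ext i
    change v i = rotLin _ _ i
    rw [rotLin_apply]
    fin_cases i <;> simp [M, originTangent]

/-- By transitivity a change of starting vector is a right translation of the group variable. -/
theorem map_rotTangent_eq_origin (p : UnitTangent) :
    haarSO3.map (fun g => rotTangent g p) = haarSO3.map fun g => rotTangent g originTangent := by
  obtain ⟨k, rfl⟩ := exists_rotTangent_originTangent p
  have h : Measurable fun g => rotTangent g originTangent :=
    (continuous_rotTangent.comp (Continuous.prodMk_left originTangent)).measurable
  have h1 : (fun g => rotTangent g (rotTangent k originTangent)) =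
      (fun g => rotTangent g originTangent) ∘ fun g => g * k :=
    funext fun g => (rotTangent_mul g k originTangent).symm
  rw [h1, ← Measure.map_map h (measurable_mul_const k), map_mul_right_haarSO3 k]

/-- The image of any unit tangent vector under a Haar-random rotation has Liouville law. -/
theorem map_rotTangent_haarSO3 (p : UnitTangent) :
    haarSO3.map (fun g => rotTangent g p) = liouvilleUnit := by
  refine Measure.ext_of_lintegral _ fun φ hφ => ?_
  have hc : ∀ q, Measurable fun g => rotTangent g q := fun q =>
    (continuous_rotTangent.comp (Continuous.prodMk_left q)).measurable
  have h1 : ∀ q, ∫⁻ g, φ (rotTangent g q) ∂haarSO3 =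
      ∫⁻ r, φ r ∂haarSO3.map (fun g => rotTangent g p) := by
    intro q
    rw [← lintegral_map hφ (hc q), map_rotTangent_eq_origin q, map_rotTangent_eq_origin p]
  -- The law does not depend on the starting vector, so that vector may be averaged over Liouville
  -- measure. After exchanging integrals, each rotation preserves this measure.
  calc ∫⁻ r, φ r ∂haarSO3.map (fun g => rotTangent g p)
      = ∫⁻ q, ∫⁻ g, φ (rotTangent g q) ∂haarSO3 ∂liouvilleUnit := by
        simp_rw [h1]; simp
    _ = ∫⁻ g, ∫⁻ q, φ (rotTangent g q) ∂liouvilleUnit ∂haarSO3 :=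
        lintegral_lintegral_swap
          (hφ.comp (continuous_rotTangent.measurable.comp measurable_swap)).aemeasurable
    _ = ∫⁻ q, φ q ∂liouvilleUnit := by
        simp_rw [(measurePreserving_rotTangent _).lintegral_comp hφ]; simp

/-! ### The action of diffeomorphisms on unit tangent vectors -/

theorem vec_ne_zero (p : UnitTangent) : (p.1.2 : E3) ≠ 0 := ne_zero_of_mem_unit_sphere p.1.2

/-- The normalized image of a unit tangent vector under the tangent map of `h`. -/
def pushTangent (h : SphereDiffeo) (p : UnitTangent) : UnitTangent :=
  ⟨(h p.1.1, ⟨‖extDeriv h p.1.1 p.1.2‖⁻¹ • extDeriv h p.1.1 p.1.2, by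
      have := norm_ne_zero_iff.2 (extDeriv_ne_zero h p.1.1 (vec_ne_zero p))
      rw [mem_sphere_zero_iff_norm, norm_smul, norm_inv, norm_norm, inv_mul_cancel₀ this]⟩), by
    rw [inner_smul_right, inner_extDeriv h p.1.1 p.2, mul_zero]⟩

/-- The logarithm of the factor by which the tangent map of `h` stretches a unit vector. -/
def logNorm (h : SphereDiffeo) (p : UnitTangent) : ℝ := Real.log ‖extDeriv h p.1.1 p.1.2‖

theorem exp_logNorm_smul (h : SphereDiffeo) (p : UnitTangent) :
    Real.exp (logNorm h p) • ((pushTangent h p).1.2 : E3) = extDeriv h p.1.1 p.1.2 := by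
  have := norm_ne_zero_iff.2 (extDeriv_ne_zero h p.1.1 (vec_ne_zero p))
  rw [logNorm, Real.exp_log (lt_of_le_of_ne (norm_nonneg _) this.symm)]
  simp only [pushTangent]
  rw [smul_smul, mul_inv_cancel₀ this, one_smul]

theorem continuous_jet_apply (p : UnitTangent) : Continuous fun h : SphereDiffeo => jet h p :=
  (UniformFun.uniformContinuous_eval (E3 × E3) p).continuous.comp
    (continuous_induced_dom (f := fun h : SphereDiffeo => UniformFun.ofFun (jet h)))

/-- Carathéodory's criterion: the jet is continuous in the vector and, for each fixed vector,
measurable in the diffeomorphism. -/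
theorem measurable_jet : Measurable fun q : UnitTangent × SphereDiffeo => jet q.2 q.1 :=
  measurable_uncurry_of_continuous_of_measurable (u := fun p (h : SphereDiffeo) => jet h p)
    continuous_jet fun p => (continuous_jet_apply p).measurable

theorem measurable_extDeriv :
    Measurable fun q : UnitTangent × SphereDiffeo => extDeriv q.2 q.1.1.1 q.1.1.2 := by
  have := measurable_jet.snd
  simp_rw [jet_eq] at this
  exact this

theorem measurable_pushTangent :
    Measurable fun q : UnitTangent × SphereDiffeo => pushTangent q.2 q.1 := by
  have h1 : Measurable fun q : UnitTangent × SphereDiffeo => (q.2 q.1.1.1 : E3) := measurable_jet.fst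
  have h2 : Measurable fun q : UnitTangent × SphereDiffeo =>
      ‖extDeriv q.2 q.1.1.1 q.1.1.2‖⁻¹ • extDeriv q.2 q.1.1.1 q.1.1.2 :=
    measurable_extDeriv.norm.inv.smul measurable_extDeriv
  exact (Measurable.prodMk (Measurable.subtype_mk (h := fun q => (q.2 q.1.1.1).2) h1)
    h2.subtype_mk).subtype_mk

theorem measurable_logNorm :
    Measurable fun q : UnitTangent × SphereDiffeo => logNorm q.2 q.1 :=
  Real.measurable_log.comp measurable_extDeriv.norm

theorem continuous_logNorm (f : SphereDiffeo) : Continuous (logNorm f) := by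
  have h : Continuous fun p : UnitTangent => extDeriv f p.1.1 p.1.2 := by
    have := (continuous_jet f).snd
    simp_rw [jet_eq] at this
    exact this
  exact h.norm.log fun p => norm_ne_zero_iff.2 (extDeriv_ne_zero f p.1.1 (vec_ne_zero p))

instance : CompactSpace UnitTangent := by
  refine isCompact_iff_compactSpace.1 (IsClosed.isCompact ?_)
  exact isClosed_eq (by fun_prop) continuous_const

theorem integrable_logNorm (f : SphereDiffeo) (m : Measure UnitTangent) [IsFiniteMeasure m] :
    Integrable (logNorm f) m := by
  obtain ⟨C, hC⟩ := isCompact_univ.exists_bound_of_continuousOn (continuous_logNorm f).continuousOn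
  exact Integrable.of_bound (continuous_logNorm f).aestronglyMeasurable C
    (Eventually.of_forall fun p => hC p (mem_univ p))

theorem extDeriv_trans_rot (f : SphereDiffeo) (g : SO3) (p : UnitTangent) :
    extDeriv (f.trans (rot g)) p.1.1 p.1.2 = rotLin g (extDeriv f p.1.1 p.1.2) := by
  have h1 := coe_sphereDeriv_rot_comp f g p.base p.vec
  rw [coe_sphereDeriv, coe_sphereDeriv] at h1
  exact h1

theorem pushTangent_trans_rot (f : SphereDiffeo) (g : SO3) (p : UnitTangent) :
    pushTangent (f.trans (rot g)) p = rotTangent g (pushTangent f p) := by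
  refine Subtype.ext (Prod.ext rfl (Subtype.ext ?_))
  simp only [pushTangent, rotTangent, rotFun]
  rw [extDeriv_trans_rot, norm_rotLin, map_smul]

/-- A random element of the coset sends any unit tangent vector to a Liouville-distributed one. -/
theorem map_pushTangent_cosetMeasure (f : SphereDiffeo) (p : UnitTangent) :
    (cosetMeasure f).map (fun h => pushTangent h p) = liouvilleUnit := by
  have hm : Measurable fun h : SphereDiffeo => pushTangent h p :=
    measurable_pushTangent.comp measurable_prodMk_left
  rw [cosetMeasure, Measure.map_map hm (continuous_coset f).measurable,
    ← map_rotTangent_haarSO3 (pushTangent f p)]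
  congr 1
  funext g
  exact pushTangent_trans_rot f g p

/-- Rotations preserve norms, so this holds on the whole coset. Equality of jet norms, over
uncountably many `p`, defines a closed set in the `C¹` topology, which settles measurability. -/
theorem ae_cosetMeasure_logNorm (f : SphereDiffeo) :
    ∀ᵐ h ∂cosetMeasure f, ∀ p, logNorm h p = logNorm f p := by
  have hcl : IsClosed {h : SphereDiffeo | ∀ p, ‖(jet h p).2‖ = ‖(jet f p).2‖} := by
    simp only [ofPred_forall]
    exact isClosed_iInter fun p =>
      isClosed_eq (continuous_jet_apply p).snd.norm continuous_const
  have h1 : ∀ᵐ h : SphereDiffeo ∂cosetMeasure f, ∀ p, ‖(jet h p).2‖ = ‖(jet f p).2‖ := by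
    rw [cosetMeasure, ae_map_iff (continuous_coset f).measurable.aemeasurable hcl.measurableSet]
    refine Eventually.of_forall fun g p => ?_
    rw [jet_eq, jet_eq]
    simp only
    rw [extDeriv_trans_rot, norm_rotLin]
  filter_upwards [h1] with h hh p
  have := hh p
  rw [jet_eq, jet_eq] at this
  exact congrArg Real.log this

/-! ### Random orbits of unit tangent vectors -/

/-- The normalized images of `p` under the compositions `h^{(n)}`. -/
def orbit (p : UnitTangent) (h : ℕ → SphereDiffeo) : ℕ → UnitTangent
  | 0 => p
  | n + 1 => pushTangent (h n) (orbit p h n)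

/-- The `n`-th orbit point depends only on the maps with index below `n`; this makes it independent
of `h n`. -/
theorem orbit_congr (p : UnitTangent) {h h' : ℕ → SphereDiffeo} {n : ℕ}
    (hh : ∀ i < n, h i = h' i) : orbit p h n = orbit p h' n := by
  induction n with
  | zero => rfl
  | succ n ih =>
    rw [orbit, orbit, ih fun i hi => hh i (hi.trans n.lt_succ_self), hh n n.lt_succ_self]

theorem measurable_orbit (n : ℕ) :
    Measurable fun q : UnitTangent × (ℕ → SphereDiffeo) => orbit q.1 q.2 n := by
  induction n with
  | zero => exact measurable_fst
  | succ n ih =>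
    exact measurable_pushTangent.comp
      (ih.prodMk ((measurable_pi_apply n).comp measurable_snd))

theorem orbit_base (p : UnitTangent) (h : ℕ → SphereDiffeo) (n : ℕ) :
    (orbit p h n).1.1 = iterComp h n p.1.1 := by
  induction n with
  | zero => rfl
  | succ n ih =>
    change h n (orbit p h n).1.1 = h n (iterComp h n p.1.1)
    rw [ih]

theorem extDeriv_refl (x : S2) (v : E3) : extDeriv (Diffeomorph.refl (𝓡 2) S2 1) x v = v := by
  have h : homExt (Diffeomorph.refl (𝓡 2) S2 1) = id := homExt_id
  rw [extDeriv, h, fderiv_id]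
  rfl

/-- The chain rule, with length and direction of the image vector kept apart. -/
theorem extDeriv_iterComp (p : UnitTangent) (h : ℕ → SphereDiffeo) (n : ℕ) :
    extDeriv (iterComp h n) p.1.1 p.1.2 =
      Real.exp (∑ k ∈ Finset.range n, logNorm (h k) (orbit p h k)) • ((orbit p h n).1.2 : E3) := by
  induction n with
  | zero =>
    rw [Finset.sum_range_zero, Real.exp_zero, one_smul]
    exact extDeriv_refl p.1.1 p.1.2
  | succ n ih =>
    rw [iterComp, extDeriv_trans, ContinuousLinearMap.comp_apply, ih, map_smul,
      Finset.sum_range_succ, Real.exp_add, mul_smul, orbit, exp_logNorm_smul, orbit_base]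

theorem log_norm_extDeriv_iterComp (p : UnitTangent) (h : ℕ → SphereDiffeo) (n : ℕ) :
    Real.log ‖extDeriv (iterComp h n) p.1.1 p.1.2‖ =
      ∑ k ∈ Finset.range n, logNorm (h k) (orbit p h k) := by
  rw [extDeriv_iterComp, norm_smul, norm_eq_of_mem_sphere, mul_one, Real.norm_eq_abs,
    Real.abs_exp, Real.log_exp]

/-! ### Independence along random orbits -/

open ProbabilityTheory in
/-- If `A (z, ·)` has the same law `m` for all `z`, then `A (Z, H)` has law `m` and is independent
of `Z`, for independent `Z` and `H`. -/
theorem indepFun_of_constant_law {Ω α β γ : Type*} [MeasurableSpace Ω] [MeasurableSpace α]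
    [MeasurableSpace β] [MeasurableSpace γ] {μ : Measure Ω} [IsProbabilityMeasure μ]
    {m : Measure γ} [IsProbabilityMeasure m] {Z : Ω → α} {H : Ω → β} (hZ : Measurable Z)
    (hH : Measurable H) (hind : IndepFun Z H μ) {A : α × β → γ} (hA : Measurable A)
    (hlaw : ∀ z, (μ.map H).map (fun b => A (z, b)) = m) :
    IndepFun Z (fun a => A (Z a, H a)) μ ∧ μ.map (fun a => A (Z a, H a)) = m := by
  have hAZ : Measurable fun a => A (Z a, H a) := hA.comp (hZ.prodMk hH)
  have : IsProbabilityMeasure (μ.map Z) := Measure.isProbabilityMeasure_map hZ.aemeasurable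
  have : IsProbabilityMeasure (μ.map H) := Measure.isProbabilityMeasure_map hH.aemeasurable
  have hprod : μ.map (fun a => (Z a, H a)) = (μ.map Z).prod (μ.map H) :=
    (indepFun_iff_map_prod_eq_prod_map_map hZ.aemeasurable hH.aemeasurable).1 hind
  -- Conditionally on `Z = z` the value has law `m` for every `z`, so the joint law is a product.
  have hjoint : μ.map (fun a => (Z a, A (Z a, H a))) = (μ.map Z).prod m := by
    refine Measure.ext_of_lintegral _ fun φ hφ => ?_
    have h1 : Measurable fun q : α × β => φ (q.1, A q) := hφ.comp (measurable_fst.prodMk hA)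
    rw [lintegral_map hφ (hZ.prodMk hAZ), lintegral_prod _ hφ.aemeasurable]
    calc ∫⁻ a, φ (Z a, A (Z a, H a)) ∂μ
        = ∫⁻ q, φ (q.1, A q) ∂μ.map (fun a => (Z a, H a)) :=
          (lintegral_map h1 (hZ.prodMk hH)).symm
      _ = ∫⁻ z, ∫⁻ b, φ (z, A (z, b)) ∂μ.map H ∂μ.map Z := by
          rw [hprod, lintegral_prod _ h1.aemeasurable]
      _ = ∫⁻ z, ∫⁻ c, φ (z, c) ∂m ∂μ.map Z := by
          refine lintegral_congr fun z => ?_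
          rw [← hlaw z]
          exact (lintegral_map (hφ.comp measurable_prodMk_left)
            (hA.comp measurable_prodMk_left)).symm
  have hmap : μ.map (fun a => A (Z a, H a)) = m := by
    have := congrArg Measure.snd hjoint
    rwa [Measure.snd_prod, Measure.snd_map_prodMk hZ] at this
  refine ⟨?_, hmap⟩
  rw [indepFun_iff_map_prod_eq_prod_map_map hZ.aemeasurable hAZ.aemeasurable, hmap, hjoint]

section Law

variable (f : SphereDiffeo) (p : UnitTangent)

/-- The law of an independent sequence of random elements of the coset of `f`. -/
abbrev pathMeasure (f : SphereDiffeo) : Measure (ℕ → SphereDiffeo) :=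
  Measure.infinitePi fun _ : ℕ => cosetMeasure f

theorem measurable_orbit_right (n : ℕ) : Measurable fun h : ℕ → SphereDiffeo => orbit p h n :=
  (measurable_orbit n).comp measurable_prodMk_left

theorem indepFun_orbit_eval {i n : ℕ} (hi : i ≤ n) :
    ProbabilityTheory.IndepFun (fun h : ℕ → SphereDiffeo => (orbit p h i, orbit p h n))
      (fun h => h n) (pathMeasure f) := by
  classical
  have hI : ProbabilityTheory.iIndepFun (fun (k : ℕ) (h : ℕ → SphereDiffeo) => h k)
      (pathMeasure f) :=
    ProbabilityTheory.iIndepFun_infinitePi (X := fun _ h => h) fun _ => measurable_id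
  have h1 := hI.indepFun_finset (Finset.range n) {n} (by simp) fun k => measurable_pi_apply k
  -- Padding with the identity makes the orbit up to time `n` a measurable function of the first `n`
  -- maps; the padded entries are never used.
  let fill : (Finset.range n → SphereDiffeo) → ℕ → SphereDiffeo := fun r k =>
    if hk : k ∈ Finset.range n then r ⟨k, hk⟩ else Diffeomorph.refl (𝓡 2) S2 1
  have hfill : Measurable fill := by
    refine measurable_pi_lambda _ fun k => ?_
    by_cases hk : k ∈ Finset.range n
    · simp only [fill, dif_pos hk]
      exact measurable_pi_apply _
    · simp only [fill, dif_neg hk]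
      exact measurable_const
  have h2 := h1.comp
    (((measurable_orbit_right p i).comp hfill).prodMk ((measurable_orbit_right p n).comp hfill))
    (measurable_pi_apply (⟨n, Finset.mem_singleton_self n⟩ : ({n} : Finset ℕ)))
  refine h2.congr (Eventually.of_forall fun h => ?_) (Eventually.of_forall fun h => rfl)
  have hj : ∀ j ≤ n, orbit p h j = orbit p (fill fun k => h k) j := by
    intro j hj
    refine orbit_congr p fun k hk => ?_
    simp only [fill, dif_pos (Finset.mem_range.2 (hk.trans_le hj))]
  exact Prod.ext (hj i hi).symm (hj n le_rfl).symm

/-- The next point is computed from `orbit p h n` and the fresh map `h n`, with the same law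
whatever the former is. Carrying the pair of points `i` and `n` as the past gives independence from
both. -/
theorem indepFun_orbit_succ {i n : ℕ} (hi : i ≤ n) :
    ProbabilityTheory.IndepFun (fun h => orbit p h i) (fun h => orbit p h (n + 1))
      (pathMeasure f) ∧ (pathMeasure f).map (fun h => orbit p h (n + 1)) = liouvilleUnit := by
  have hA : Measurable fun q : (UnitTangent × UnitTangent) × SphereDiffeo =>
      pushTangent q.2 q.1.2 := 
    measurable_pushTangent.comp ((measurable_snd.comp measurable_fst).prodMk measurable_snd)
  have hev : (pathMeasure f).map (fun h => h n) = cosetMeasure f :=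
    Measure.infinitePi_map_eval _ n
  have := indepFun_of_constant_law (m := liouvilleUnit)
    ((measurable_orbit_right p i).prodMk (measurable_orbit_right p n)) (measurable_pi_apply n)
    (indepFun_orbit_eval f p hi) hA (fun z => by
      rw [hev]; exact map_pushTangent_cosetMeasure f z.2)
  exact ⟨this.1.comp measurable_fst measurable_id, this.2⟩

/-- The strong law needs only pairwise independence and a common law. The index starts at one
because `orbit p h 0 = p` is deterministic. -/
theorem ae_tendsto_average_logNorm_orbit :
    ∀ᵐ h ∂pathMeasure f, Tendsto
      (fun n : ℕ => (∑ k ∈ Finset.range n, logNorm f (orbit p h (k + 1))) / n) atTop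
      (𝓝 (∫ q, logNorm f q ∂liouvilleUnit)) := by
  have hm : Measurable (logNorm f) := (continuous_logNorm f).measurable
  have hlaw : ∀ k, (pathMeasure f).map (fun h => orbit p h (k + 1)) = liouvilleUnit :=
    fun k => (indepFun_orbit_succ f p le_rfl).2
  have hint : ∫ q, logNorm f q ∂liouvilleUnit =
      ∫ h, logNorm f (orbit p h (0 + 1)) ∂pathMeasure f := by
    rw [← hlaw 0, integral_map (measurable_orbit_right p _).aemeasurable hm.aestronglyMeasurable]
  rw [hint]
  refine ProbabilityTheory.strong_law_ae_real (fun k h => logNorm f (orbit p h (k + 1))) ?_ ?_ ?_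
  · have := integrable_logNorm f ((pathMeasure f).map fun h => orbit p h (0 + 1))
    exact (integrable_map_measure hm.aestronglyMeasurable
      (measurable_orbit_right p _).aemeasurable).1 this
  · have key : ∀ i j, i < j → ProbabilityTheory.IndepFun
        (fun h => logNorm f (orbit p h (i + 1))) (fun h => logNorm f (orbit p h (j + 1)))
        (pathMeasure f) := fun i j hij => (indepFun_orbit_succ f p hij).1.comp hm hm
    intro i j hij
    rcases lt_or_gt_of_ne hij with h | h
    · exact key i j h
    · exact (key j i h).symm
  · intro k
    have : ProbabilityTheory.IdentDistrib (fun h => orbit p h (k + 1))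
        (fun h => orbit p h (0 + 1)) (pathMeasure f) (pathMeasure f) :=
      ⟨(measurable_orbit_right p _).aemeasurable, (measurable_orbit_right p _).aemeasurable,
        (hlaw k).trans (hlaw 0).symm⟩
    exact this.comp hm

theorem ae_logNorm_eval :
    ∀ᵐ h ∂pathMeasure f, ∀ k q, logNorm (h k) q = logNorm f q := by
  rw [ae_all_iff]
  intro k
  have hq := (measurePreserving_eval_infinitePi (fun _ : ℕ => cosetMeasure f) k).quasiMeasurePreserving
  exact hq.ae (ae_cosetMeasure_logNorm f)

theorem tendsto_average_of_tail {a : ℕ → ℝ} {R : ℝ}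
    (h : Tendsto (fun n : ℕ => (∑ k ∈ Finset.range n, a (k + 1)) / n) atTop (𝓝 R)) :
    Tendsto (fun n : ℕ => (1 / (n : ℝ)) * ∑ k ∈ Finset.range n, a k) atTop (𝓝 R) := by
  rw [← tendsto_add_atTop_iff_nat 1]
  have h1 : Tendsto (fun n : ℕ => (n : ℝ) / (n + 1)) atTop (𝓝 1) := tendsto_natCast_div_add_atTop 1
  have h2 : Tendsto (fun n : ℕ => a 0 * (1 / ((n : ℝ) + 1))) atTop (𝓝 (a 0 * 0)) :=
    tendsto_one_div_add_atTop_nhds_zero_nat.const_mul _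
  have h3 := (h.mul h1).add h2
  rw [mul_one, mul_zero, add_zero] at h3
  refine h3.congr fun n => ?_
  rw [Finset.sum_range_succ']
  push_cast
  rcases Nat.eq_zero_or_pos n with rfl | hn
  · simp
  · have : (n : ℝ) ≠ 0 := by positivity
    field_simp

theorem ae_tendsto_log_norm_extDeriv :
    ∀ᵐ h ∂pathMeasure f, Tendsto
      (fun n : ℕ => (1 / (n : ℝ)) * Real.log ‖extDeriv (iterComp h n) p.1.1 p.1.2‖) atTop
      (𝓝 (∫ q, logNorm f q ∂liouvilleUnit)) := by
  filter_upwards [ae_tendsto_average_logNorm_orbit f p, ae_logNorm_eval f] with h h1 h2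
  simp_rw [log_norm_extDeriv_iterComp, h2]
  exact tendsto_average_of_tail (a := fun k => logNorm f (orbit p h k)) h1

end Law

/-! ### The random exponent -/

/-- The norm of a linear map on a tangent plane is comparable to its values on the frame. -/
theorem norm_le_of_frame {W : Type*} [NormedAddCommGroup W] [NormedSpace ℝ W] (x : S2)
    (L : (ℝ ∙ (x : E3))ᗮ →L[ℝ] W) (T : E3 →L[ℝ] E3) (hT : ∀ v, ‖L v‖ = ‖T v‖) :
    ‖T (frameFst x)‖ ≤ ‖L‖ ∧ ‖L‖ ≤ ‖T (frameFst x)‖ + ‖T (frameSnd x)‖ := by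
  constructor
  · have h1 := L.le_opNorm
      ⟨frameFst x, Submodule.mem_orthogonal_singleton_iff_inner_right.2 (inner_frameFst x)⟩
    rwa [hT, Submodule.coe_norm, norm_frameFst, mul_one] at h1
  · refine ContinuousLinearMap.opNorm_le_of_unit_norm (by positivity) fun v hv => ?_
    obtain ⟨θ, hθ⟩ := exists_unitVec_eq x (v := (v : E3)) hv
      (Submodule.mem_orthogonal_singleton_iff_inner_right.1 v.2)
    rw [hT, hθ, unitVec, map_add, map_smul, map_smul]
    refine (norm_add_le _ _).trans (add_le_add ?_ ?_)
    · rw [norm_smul]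
      exact mul_le_of_le_one_left (norm_nonneg _) (Real.abs_cos_le_one θ)
    · rw [norm_smul]
      exact mul_le_of_le_one_left (norm_nonneg _) (Real.abs_sin_le_one θ)

theorem norm_sphereDeriv_bounds (F : SphereDiffeo) (x : S2) :
    ‖extDeriv F x (frameFst x)‖ ≤ ‖sphereDeriv F x‖ ∧
      ‖sphereDeriv F x‖ ≤ ‖extDeriv F x (frameFst x)‖ + ‖extDeriv F x (frameSnd x)‖ :=
  norm_le_of_frame x (sphereDeriv F x) (extDeriv F x) fun v => by
    rw [← coe_sphereDeriv, Submodule.coe_norm]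

/-- `N` lies between `u` and `2 max(u, w)`, and the factor two disappears after division by `n`. -/
theorem tendsto_log_of_le_add {u w N : ℕ → ℝ} {R : ℝ} (hu : ∀ n, 0 < u n)
    (h1 : ∀ n, u n ≤ N n) (h2 : ∀ n, N n ≤ u n + w n)
    (hu' : Tendsto (fun n : ℕ => (1 / (n : ℝ)) * Real.log (u n)) atTop (𝓝 R))
    (hw' : Tendsto (fun n : ℕ => (1 / (n : ℝ)) * Real.log (w n)) atTop (𝓝 R)) :
    Tendsto (fun n : ℕ => (1 / (n : ℝ)) * Real.log (N n)) atTop (𝓝 R) := by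
  have hup : Tendsto (fun n : ℕ => (1 / (n : ℝ)) * Real.log 2 +
      max ((1 / (n : ℝ)) * Real.log (u n)) ((1 / (n : ℝ)) * Real.log (w n))) atTop (𝓝 R) := by
    have := (tendsto_one_div_atTop_nhds_zero_nat.mul_const (Real.log 2)).add (hu'.max hw')
    rwa [zero_mul, max_self, zero_add] at this
  refine tendsto_of_tendsto_of_tendsto_of_le_of_le hu' hup (fun n => ?_) fun n => ?_
  · exact mul_le_mul_of_nonneg_left (Real.log_le_log (hu n) (h1 n)) (by positivity)
  · change (1 / (n : ℝ)) * Real.log (N n) ≤ _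
    have hm : 0 < max (u n) (w n) := lt_max_of_lt_left (hu n)
    rw [← mul_max_of_nonneg _ _ (by positivity), ← mul_add]
    refine mul_le_mul_of_nonneg_left ?_ (by positivity)
    have h3 : N n ≤ 2 * max (u n) (w n) := by
      linarith [h2 n, le_max_left (u n) (w n), le_max_right (u n) (w n)]
    refine (Real.log_le_log ((hu n).trans_le (h1 n)) h3).trans ?_
    rw [Real.log_mul two_ne_zero hm.ne']
    gcongr
    rcases le_total (u n) (w n) with h | h
    · rw [max_eq_right h]; exact le_max_right _ _
    · rw [max_eq_left h]; exact le_max_left _ _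

theorem measurable_logNorm_orbit (k : ℕ) :
    Measurable fun q : UnitTangent × (ℕ → SphereDiffeo) => logNorm (q.2 k) (orbit q.1 q.2 k) := by
  have := measurable_logNorm.comp
    ((measurable_orbit k).prodMk ((measurable_pi_apply k).comp measurable_snd))
  exact this

theorem measurable_average_log (θ : ℝ) (n : ℕ) :
    Measurable fun q : S2 × (ℕ → SphereDiffeo) =>
      (1 / (n : ℝ)) * Real.log ‖extDeriv (iterComp q.2 n) q.1 (unitVec q.1 θ)‖ := by
  have hp : Measurable fun q : S2 × (ℕ → SphereDiffeo) => unitTangentOf (q.1, θ) :=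
    measurable_unitTangentOf.comp (measurable_fst.prodMk measurable_const)
  -- The orbit sum reduces measurability to that of single jets, so composition need not be studied
  -- as a map on diffeomorphisms.
  have h : ∀ q : S2 × (ℕ → SphereDiffeo),
      Real.log ‖extDeriv (iterComp q.2 n) q.1 (unitVec q.1 θ)‖ =
        ∑ k ∈ Finset.range n, logNorm (q.2 k) (orbit (unitTangentOf (q.1, θ)) q.2 k) :=
    fun q => log_norm_extDeriv_iterComp (unitTangentOf (q.1, θ)) q.2 n
  have h1 : ∀ k, Measurable fun q : S2 × (ℕ → SphereDiffeo) =>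
      logNorm (q.2 k) (orbit (unitTangentOf (q.1, θ)) q.2 k) := by
    intro k
    have := (measurable_logNorm_orbit k).comp (hp.prodMk measurable_snd)
    exact this
  simp_rw [h]
  exact (Finset.measurable_fun_sum _ fun k _ => h1 k).const_mul _

/-- Convergence is almost sure for each fixed `x`; Fubini for null sets exchanges the quantifiers.
-/
theorem ae_ae_tendsto_log_norm_extDeriv (f : SphereDiffeo) (θ : ℝ) :
    ∀ᵐ h ∂pathMeasure f, ∀ᵐ x : S2 ∂area, Tendsto
      (fun n : ℕ => (1 / (n : ℝ)) * Real.log ‖extDeriv (iterComp h n) x (unitVec x θ)‖) atTop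
      (𝓝 (∫ q, logNorm f q ∂liouvilleUnit)) := by
  have hS : MeasurableSet {q : S2 × (ℕ → SphereDiffeo) | Tendsto
      (fun n : ℕ => (1 / (n : ℝ)) *
        Real.log ‖extDeriv (iterComp q.2 n) q.1 (unitVec q.1 θ)‖) atTop
      (𝓝 (∫ q, logNorm f q ∂liouvilleUnit))} :=
    measurableSet_tendsto _ fun n => measurable_average_log θ n
  refine (Measure.ae_ae_comm (p := fun (x : S2) (h : ℕ → SphereDiffeo) => Tendsto
    (fun n : ℕ => (1 / (n : ℝ)) * Real.log ‖extDeriv (iterComp h n) x (unitVec x θ)‖) atTop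
    (𝓝 (∫ q, logNorm f q ∂liouvilleUnit))) hS).1 (Eventually.of_forall fun x => ?_)
  exact ae_tendsto_log_norm_extDeriv f (unitTangentOf (x, θ))

theorem hasRandomExponent_cosetMeasure (f : SphereDiffeo) :
    HasRandomExponent (cosetMeasure f) (∫ q, logNorm f q ∂liouvilleUnit) := by
  -- The angles `0` and `π/2` give the two frame vectors, whose images bound the operator norm.
  filter_upwards [ae_ae_tendsto_log_norm_extDeriv f 0,
    ae_ae_tendsto_log_norm_extDeriv f (Real.pi / 2)] with h h1 h2
  refine ⟨fun _ => ∫ q, logNorm f q ∂liouvilleUnit, ?_, integrable_const _, by simp⟩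
  filter_upwards [h1, h2] with x hx1 hx2
  simp_rw [unitVec_zero] at hx1
  simp_rw [unitVec_pi_div_two] at hx2
  have ha : frameFst x ≠ 0 := norm_ne_zero_iff.1 (by rw [norm_frameFst]; exact one_ne_zero)
  exact tendsto_log_of_le_add (fun n => norm_pos_iff.2 (extDeriv_ne_zero _ x ha))
    (fun n => (norm_sphereDeriv_bounds _ x).1) (fun n => (norm_sphereDeriv_bounds _ x).2) hx1 hx2

/-! ### Integration over the projective bundle -/

theorem logStretch_mk (f : SphereDiffeo) (p : UnitTangent) :
    logStretch f (Quotient.mk lineSetoid p) = logNorm f p :=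
  congrArg (fun y : E3 => Real.log ‖y‖) (coe_sphereDeriv f p.base p.vec)

theorem measurable_logStretch (f : SphereDiffeo) : Measurable (logStretch f) := by
  refine measurable_from_quotient.2 ?_
  have h : logStretch f ∘ Quotient.mk'' = logNorm f := funext (logStretch_mk f)
  rw [h]
  exact (continuous_logNorm f).measurable

theorem measurable_mk_lineSetoid : Measurable (Quotient.mk lineSetoid) := measurable_quotient_mk''

theorem integrable_logStretch (f : SphereDiffeo) : Integrable (logStretch f) liouville := by
  rw [liouville, integrable_map_measure (measurable_logStretch f).aestronglyMeasurable
    measurable_mk_lineSetoid.aemeasurable]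
  exact (integrable_logNorm f liouvilleUnit).congr
    (Eventually.of_forall fun p => (logStretch_mk f p).symm)

theorem integral_logStretch (f : SphereDiffeo) :
    ∫ v, logStretch f v ∂liouville = ∫ q, logNorm f q ∂liouvilleUnit := by
  rw [liouville, integral_map measurable_mk_lineSetoid.aemeasurable
    (measurable_logStretch f).aestronglyMeasurable]
  simp_rw [logStretch_mk]

/-! ### Positivity -/

/-- The mean over the unit circle of the tangent plane at `x` of the logarithm of the stretching
factor. -/
theorem integral_logNorm_fibre (f : SphereDiffeo) (hf : MeasurePreserving f area area) (x : S2) :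
    ∫ θ, logNorm f (unitTangentOf (x, θ)) ∂angleMeasure =
      Real.log ((‖extDeriv f x (frameFst x)‖ ^ 2 + ‖extDeriv f x (frameSnd x)‖ ^ 2 + 2) / 4) / 2 := by
  have ha : frameFst x ≠ 0 := norm_ne_zero_iff.1 (by rw [norm_frameFst]; exact one_ne_zero)
  have hE : 0 < ‖extDeriv f x (frameFst x)‖ ^ 2 :=
    pow_pos (norm_pos_iff.2 (extDeriv_ne_zero f x ha)) 2
  rw [← average_log_quadratic hE (gram_extDeriv f hf x)]
  simp_rw [← norm_extDeriv_unitVec_sq, Real.log_pow]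
  rw [angleMeasure, ProbabilityTheory.cond, integral_smul_measure,
    intervalIntegral.integral_const_mul, intervalIntegral.integral_of_le (by positivity),
    Real.volume_Ioc, ENNReal.toReal_inv, ENNReal.toReal_ofReal (by simp [Real.pi_pos.le]), sub_zero,
    smul_eq_mul]
  simp only [logNorm, unitTangentOf]
  push_cast
  ring

theorem integral_logNorm_eq (f : SphereDiffeo) :
    ∫ q, logNorm f q ∂liouvilleUnit =
      ∫ x, ∫ θ, logNorm f (unitTangentOf (x, θ)) ∂angleMeasure ∂area := by
  have hm := (continuous_logNorm f).measurable
  have hi := integrable_logNorm f liouvilleUnit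
  rw [liouvilleUnit_eq] at hi ⊢
  rw [integral_map measurable_unitTangentOf.aemeasurable hm.aestronglyMeasurable]
  exact integral_prod _ (hi.comp_measurable measurable_unitTangentOf)

/-- `EG = 1 + F² ≥ 1`, followed by the inequality of arithmetic and geometric means. -/
theorem two_le_norm_sq_add (f : SphereDiffeo) (hf : MeasurePreserving f area area) (x : S2) :
    2 ≤ ‖extDeriv f x (frameFst x)‖ ^ 2 + ‖extDeriv f x (frameSnd x)‖ ^ 2 := by
  have hg := gram_extDeriv f hf x
  have h1 : 1 ≤ (‖extDeriv f x (frameFst x)‖ * ‖extDeriv f x (frameSnd x)‖) ^ 2 := by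
    rw [mul_pow]
    nlinarith [sq_nonneg ⟪extDeriv f x (frameFst x), extDeriv f x (frameSnd x)⟫]
  have h2 := one_le_sq_iff_one_le_abs _ |>.1 h1
  rw [abs_of_nonneg (by positivity)] at h2
  nlinarith [sq_nonneg (‖extDeriv f x (frameFst x)‖ - ‖extDeriv f x (frameSnd x)‖)]

theorem norm_extDeriv_of_norm_sq_add_eq_two (f : SphereDiffeo)
    (hf : MeasurePreserving f area area) (x : S2)
    (h : ‖extDeriv f x (frameFst x)‖ ^ 2 + ‖extDeriv f x (frameSnd x)‖ ^ 2 = 2) (v : E3) :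
    ‖extDeriv f x v‖ = ‖v‖ := by
  have hg := gram_extDeriv f hf x
  generalize hE : ‖extDeriv f x (frameFst x)‖ ^ 2 = E at *
  generalize hG : ‖extDeriv f x (frameSnd x)‖ ^ 2 = G at *
  generalize hF : ⟪extDeriv f x (frameFst x), extDeriv f x (frameSnd x)⟫ = F at *
  have hGE : G = 2 - E := by linarith
  subst hGE
  -- Substituting `G = 2 - E` in `EG - F² = 1` leaves a vanishing sum of squares.
  have h1 : (E - 1) ^ 2 + F ^ 2 = 0 := by linarith
  have hE1 : E = 1 := by nlinarith [sq_nonneg (E - 1), sq_nonneg F]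
  have hF0 : F = 0 := by nlinarith [sq_nonneg (E - 1), sq_nonneg F]
  refine norm_extDeriv_of_orthonormal f x ?_ ?_ (hF.trans hF0) v
  · rw [← sq_eq_sq₀ (norm_nonneg _) zero_le_one, hE, hE1, one_pow]
  · rw [← sq_eq_sq₀ (norm_nonneg _) zero_le_one, hG, hE1]; norm_num

/-- The set of good points is closed, and dense because area charges every nonempty open set. -/
theorem isometry_of_ae_norm_extDeriv (f : SphereDiffeo)
    (h : ∀ᵐ x : S2 ∂area, ∀ v : E3, ‖extDeriv f x v‖ = ‖v‖) : Isometry f := by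
  have hcl : IsClosed {x : S2 | ∀ v : E3, ‖extDeriv f x v‖ = ‖v‖} := by
    simp only [ofPred_forall]
    exact isClosed_iInter fun v =>
      isClosed_eq ((continuous_extDeriv_coe f).clm_apply continuous_const).norm continuous_const
  have hd : Dense {x : S2 | ∀ v : E3, ‖extDeriv f x v‖ = ‖v‖} := Measure.dense_of_ae h
  have hu := hcl.closure_eq.symm.trans hd.closure_eq
  exact isometry_of_norm_extDeriv f fun x => (hu.symm ▸ mem_univ x :)

theorem integral_logNorm_pos (f : SphereDiffeo) (hf : MeasurePreserving f area area)
    (hiso : ¬ Isometry f) : 0 < ∫ q, logNorm f q ∂liouvilleUnit := by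
  rw [integral_logNorm_eq]
  have hnn : ∀ x, 0 ≤ ∫ θ, logNorm f (unitTangentOf (x, θ)) ∂angleMeasure := by
    intro x
    rw [integral_logNorm_fibre f hf x]
    have := two_le_norm_sq_add f hf x
    exact div_nonneg (Real.log_nonneg (by linarith)) zero_le_two
  have hint : Integrable (fun x => ∫ θ, logNorm f (unitTangentOf (x, θ)) ∂angleMeasure) area := by
    have hi := integrable_logNorm f liouvilleUnit
    rw [liouvilleUnit_eq] at hi
    exact (hi.comp_measurable measurable_unitTangentOf).integral_prod_left
  refine lt_of_le_of_ne (integral_nonneg hnn) fun h0 => hiso ?_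
  -- The fibre means are nonnegative with zero integral, hence vanish almost everywhere, which is
  -- the equality case `E + G = 2`.
  have h1 := (integral_eq_zero_iff_of_nonneg hnn hint).1 h0.symm
  refine isometry_of_ae_norm_extDeriv f ?_
  filter_upwards [h1] with x hx
  rw [Pi.zero_apply, integral_logNorm_fibre f hf x, div_eq_zero_iff] at hx
  have h2 := two_le_norm_sq_add f hf x
  have h3 := Real.eq_one_of_pos_of_log_eq_zero (by linarith) (hx.resolve_right two_ne_zero)
  exact norm_extDeriv_of_norm_sq_add_eq_two f hf x (by linarith)

end RandomSphere
end

theorem mainTheorem5 (f : SphereDiffeo) (hf : MeasurePreserving f area area) :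
    Integrable (logStretch f) liouville ∧
    ∃ R : ℝ, HasRandomExponent (cosetMeasure f) R ∧
      R = ∫ v, logStretch f v ∂liouville ∧
      (¬ Isometry f → 0 < R) := by
  exact ⟨integrable_logStretch f, _, hasRandomExponent_cosetMeasure f,
    (integral_logStretch f).symm, integral_logNorm_pos f hf⟩
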